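/- **Definitions.** For $k\ge 1$ and a finite field $\mathbb{F}_q$ with $q$ elements, the generalized Paley graph $\Gamma(k,q)$ is the Cayley (di)graph with vertex set $\mathbb{F}_q$ in which there is an edge from $v$ to $w$ if and only if $w-v\in\{x^k : x\in\mathbb{F}_q^*\}$. For a finite graph $\Gamma$, $Spec(\Gamma)=\{[\lambda_1]^{e_1},\dots,[\lambda_s]^{e_s}\}$ denotes the collection of the different eigenvalues $\lambda_j$ of its adjacency matrix together with their multiplicities $e_j$. **Theorem.** Let $p$ be a prime with $p\equiv 1 \pmod 4$ and let $\ell\ge 1$ be an integer. 1. The spectrum of $\Gamma(4,p^{4\ell})$ is determined by the spectrum of $\Gamma(4,p^4)$: there is a function $F$, not depending on $p$, such that $Spec(\Gamma(4,p^{4\ell}))=F(\ell,Spec(\Gamma(4,p^4)))$ for all such $p$ and $\ell$. Explicitly, for integers $c,d$ and $j\ge 1$ put $$c^{(j)}= \tfrac 12 (c+2 d\, i)^{j}+ \tfrac 12 (c-2 d\, i)^{j}, \qquad d^{(j)}= -\tfrac{i}{4} (c+2 d\, i)^{j}+ \tfrac{i}{4}(c-2 d\, i)^{j},$$ (so that $c^{(j)}+2d^{(j)}i=(c+2d\,i)^{j}$),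 let $n_j=\frac{p^{4j}-1}4$, and let $S_j(c,d)$ be the multiset that consists of $n_j$, taken once, and of the four numbers $$\tfrac{p^{2j} + 4d^{(j)}p^{j}-1}{4},\quad \tfrac{p^{2j} - 4d^{(j)}p^{j}-1}{4},\quad \tfrac{-p^{2j} + 2c^{(j)}p^{j}-1}{4},\quad \tfrac{-p^{2j} - 2c^{(j)}p^{j}-1}{4},$$ each taken $n_j$ times. If $c,d$ are any integers such that the eigenvalues of $\Gamma(4,p^4)$, counted with multiplicity, form $S_1(c,d)$, then the eigenvalues of $\Gamma(4,p^{4\ell})$, counted with multiplicity, form $S_\ell(c,d)$. 2. There are integers $c_1,d_1$ with $p^2=c_1^2+4d_1^2$, $c_1\equiv 1\pmod 4$ and $(c_1,p)=1$. For all such integers $c_1,d_1$, with $n_\ell=\frac{p^{4\ell}-1}4$, $$c_{\ell}= \tfrac 12 (c_1+2 d_1 i)^{\ell}+ \tfrac 12 (c_1-2 d_1 i)^{\ell} \qquad\text{and}\qquad d_{\ell}= -\tfrac{i}{4} (c_1+2 d_1 i)^{\ell}+ \tfrac{i}{4}(c_1-2 d_1 i)^{\ell},$$ one has $$Spec(\Gamma(4,p^{4\ell}))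 = \Big\{ [n_{\ell}]^1, \big[\tfrac{p^{2\ell} + 4d_{\ell}p^{\ell}-1}{4}\big]^{n_{\ell}}, \big[\tfrac{p^{2\ell} - 4d_{\ell}p^{\ell}-1}{4}\big]^{n_{\ell}}, \big[\tfrac{-p^{2\ell} + 2c_{\ell} p^{\ell}-1}{4}\big]^{n_{\ell}}, \big[\tfrac{-p^{2\ell} - 2c_{\ell} p^{\ell}-1}{4}\big]^{n_{\ell}}\Big\},$$ and the five listed eigenvalues are pairwise distinct. -/

import Mathlib

namespace GPGraph

/-- The Cayley (di)graph `X(G,S)`: there is an edge from `v` to `w` iff `w - v ∈ S`.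
(`SimpleGraph.addCayley` is its symmetrization; here the edges are directed.) -/
def cayleyDigraph {G : Type*} [AddGroup G] (S : Set G) : Digraph G where
  Adj v w := w - v ∈ S

/-- The set `R_k` of nonzero `k`-th powers of a field. -/
def powerSet (k : ℕ) (K : Type*) [Field K] : Set K :=
  {y | ∃ x : K, x ≠ 0 ∧ y = x ^ k}

/-- The generalized Paley graph `Γ(k,q)`, where `K` is a finite field with `q` elements. -/
def genPaley (k : ℕ) (K : Type*) [Field K] : Digraph K :=
  cayleyDigraph (powerSet k K)

open Classical in
/-- The adjacency matrix of a (di)graph, with complex entries. -/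
noncomputable def adjMatrix {V : Type*} (Γ : Digraph V) : Matrix V V ℂ :=
  Matrix.of fun v w => if Γ.Adj v w then 1 else 0

open Classical in
/-- The spectrum of a finite (di)graph: the multiset of the complex eigenvalues of its adjacency
matrix, i.e. of the roots of its characteristic polynomial, counted with multiplicity. -/
noncomputable def spec {V : Type*} [Fintype V] (Γ : Digraph V) : Multiset ℂ :=
  (adjMatrix Γ).charpoly.roots

/-- `c_ℓ = ½ (c₁ + 2 d₁ i)^ℓ + ½ (c₁ - 2 d₁ i)^ℓ`. -/
noncomputable def cSeq (c₁ d₁ : ℤ) (ℓ : ℕ) : ℂ :=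
  1 / 2 * ((c₁ : ℂ) + 2 * d₁ * Complex.I) ^ ℓ + 1 / 2 * ((c₁ : ℂ) - 2 * d₁ * Complex.I) ^ ℓ

/-- `d_ℓ = -(i/4) (c₁ + 2 d₁ i)^ℓ + (i/4) (c₁ - 2 d₁ i)^ℓ`. -/
noncomputable def dSeq (c₁ d₁ : ℤ) (ℓ : ℕ) : ℂ :=
  -(Complex.I / 4) * ((c₁ : ℂ) + 2 * d₁ * Complex.I) ^ ℓ
    + Complex.I / 4 * ((c₁ : ℂ) - 2 * d₁ * Complex.I) ^ ℓ

/-- `n_ℓ = (p^{4ℓ} - 1) / 4` (the division is exact for odd `p`). -/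
def nSeq (p ℓ : ℕ) : ℕ := (p ^ (4 * ℓ) - 1) / 4

/-- The four non-principal eigenvalues, for given values `c` and `d` of `c_ℓ` and `d_ℓ`. -/
noncomputable def nonPrincipal (p ℓ : ℕ) (c d : ℂ) : List ℂ :=
  [((p : ℂ) ^ (2 * ℓ) + 4 * d * (p : ℂ) ^ ℓ - 1) / 4,
   ((p : ℂ) ^ (2 * ℓ) - 4 * d * (p : ℂ) ^ ℓ - 1) / 4,
   (-(p : ℂ) ^ (2 * ℓ) + 2 * c * (p : ℂ) ^ ℓ - 1) / 4,
   (-(p : ℂ) ^ (2 * ℓ) - 2 * c * (p : ℂ) ^ ℓ - 1) / 4]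

/-- `{[n_ℓ]^1, [λ₁]^{n_ℓ}, [λ₂]^{n_ℓ}, [λ₃]^{n_ℓ}, [λ₄]^{n_ℓ}}` as a multiset, where `λ₁, …, λ₄`
are the entries of `nonPrincipal p ℓ c d`. -/
noncomputable def specForm (p ℓ : ℕ) (c d : ℂ) : Multiset ℂ :=
  {(nSeq p ℓ : ℂ)} + ((nonPrincipal p ℓ c d).map fun x => Multiset.replicate (nSeq p ℓ) x).sum

/-- `c₁, d₁` are integers with `p² = c₁² + 4 d₁²`, `c₁ ≡ 1 (mod 4)` and `(c₁, p) = 1`. -/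
def IsBaseSolution (p : ℕ) (c₁ d₁ : ℤ) : Prop :=
  (p : ℤ) ^ 2 = c₁ ^ 2 + 4 * d₁ ^ 2 ∧ c₁ ≡ 1 [ZMOD 4] ∧ IsCoprime c₁ (p : ℤ)

end GPGraph

/-! The additive characters diagonalise the adjacency matrix, so the nonprincipal eigenvalues are
the quartic Gaussian periods. Expanding the indicator of the fourth powers in quartic characters
expresses them by the Gauss sums G₁, G₂, G₃ of χ, χ², χ³ (`spec_genPaley_eq_gauss`). Let q = p^(4ℓ)
and P = p^ℓ. Since χ(-1) = 1, G₁G₃ = G₂² = q, and G₁² = J·G₂ with J the Jacobi sum of χ and χ².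

The arithmetic lies in J, a Gaussian integer of norm q. It is -1 modulo 2 + 2i
(`exists_jacobiSum_add_one_eq`), and p does not divide it, since its image in the field is, up to
sign, a central binomial coefficient prime to p (`not_dvd_jacobiSum`). Unique factorization leaves J
= -z^(2ℓ) or its conjugate, where z = c₁ + 2d₁i (`eq_neg_pow_of_congr`). The signs of G₁ and G₂ stay
unknown, but they only permute the four periods (`periods_eq`).

For the first claim, the multiset for ℓ = 1 determines p by its size and c, d up to sign by its
power sums; sign changes do not affect the multiset for any ℓ (`specForm_seq_eq_of_specForm_eq'`).
-/

namespace GPGraph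

open GaussianInt

/-! ### Gaussian integers whose norm is a power of p -/

theorem prime_of_norm_eq_prime {p : ℕ} (hp : p.Prime) {x : GaussianInt} (hx : x.norm = p) :
    Prime x := by
  refine Irreducible.prime ⟨fun h => ?_, fun a b hab => ?_⟩
  · rw [← Zsqrtd.norm_eq_one_iff' (by norm_num), hx] at h
    exact hp.one_lt.ne' (by exact_mod_cast h)
  · rw [hab, Zsqrtd.norm_mul] at hx
    have h := congrArg Int.natAbs hx
    rw [Int.natAbs_mul, Int.natAbs_natCast] at h
    rw [← Zsqrtd.norm_eq_one_iff, ← Zsqrtd.norm_eq_one_iff]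
    rcases hp.eq_one_or_self_of_dvd _ (Dvd.intro _ h) with h1 | h1
    · exact Or.inl h1
    · right
      rw [h1] at h
      exact Nat.eq_of_mul_eq_mul_left hp.pos (by simpa using h)

theorem natCast_dvd_iff_re_im (p : ℕ) (x : GaussianInt) :
    (p : GaussianInt) ∣ x ↔ (p : ℤ) ∣ x.re ∧ (p : ℤ) ∣ x.im := by
  have := Zsqrtd.intCast_dvd (d := -1) (p : ℤ) x
  simpa using this

/-- A prime `p ≡ 1 (mod 4)` is the norm of a Gaussian prime that is not associated with its
conjugate. -/
theorem exists_prime_norm_eq {p : ℕ} (hp : p.Prime) (h4 : p ≡ 1 [MOD 4]) :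
    ∃ π : GaussianInt, π.norm = p ∧ ¬ star π ∣ π := by
  have := Fact.mk hp
  obtain ⟨a, b, hab⟩ := Nat.Prime.sq_add_sq (p := p) (by have : p % 4 = 1 := h4; omega)
  have hn : (⟨a, b⟩ : GaussianInt).norm = p := by
    rw [Zsqrtd.norm_def, ← hab]; push_cast; ring
  refine ⟨⟨a, b⟩, hn, fun h => ?_⟩
  -- If the conjugate divides π, it divides the trace 2a. Taking norms, p divides 4a², hence a and
  -- b, and then p² divides a² + b² = p.
  have h2 : (star ⟨a, b⟩ : GaussianInt) ∣ 2 * a := by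
    have : (2 * a : GaussianInt) = ⟨a, b⟩ + star ⟨a, b⟩ := by
      ext <;> simp; ring
    rw [this]
    exact dvd_add h dvd_rfl
  have h3 := map_dvd (Zsqrtd.normMonoidHom (d := -1)) h2
  change Zsqrtd.norm _ ∣ Zsqrtd.norm _ at h3
  rw [Zsqrtd.norm_conj, hn] at h3
  have h5 : (2 * a : GaussianInt).norm = ((2 * a * (2 * a) : ℕ) : ℤ) := by
    simp [Zsqrtd.norm_def]
  rw [h5, Int.natCast_dvd_natCast] at h3
  have h6 : p ∣ 2 * a := by rcases hp.dvd_mul.1 h3 with h | h <;> exact h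
  have h7 : p ∣ a := by
    rcases hp.dvd_mul.1 h6 with h | h
    · have := (Nat.prime_dvd_prime_iff_eq hp Nat.prime_two).1 h
      subst this; exact absurd h4 (by decide)
    · exact h
  have h8 : p ∣ b ^ 2 := by
    have : p ∣ a ^ 2 + b ^ 2 := hab ▸ dvd_rfl
    exact (Nat.dvd_add_right (dvd_pow h7 two_ne_zero)).1 this
  have h9 := hp.dvd_of_dvd_pow h8
  have : p ^ 2 ∣ p := by
    conv_rhs => rw [← hab]
    exact dvd_add (pow_dvd_pow_of_dvd h7 2) (pow_dvd_pow_of_dvd h9 2)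
  have := Nat.le_of_dvd hp.pos this
  nlinarith [hp.one_lt]

theorem associated_of_dvd_of_norm_eq {x y : GaussianInt} (h : x ∣ y) (hn : x.norm = y.norm)
    (hy : y.norm ≠ 0) : Associated x y := by
  obtain ⟨u, rfl⟩ := h
  rw [Zsqrtd.norm_mul] at hn hy
  have : u.norm = 1 := by
    have h1 : x.norm * u.norm = x.norm * 1 := by rw [mul_one]; exact hn.symm
    exact mul_left_cancel₀ (left_ne_zero_of_mul hy) h1
  have hu := (Zsqrtd.norm_eq_one_iff' (by norm_num) u).1 this
  exact ⟨hu.unit, rfl⟩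

theorem norm_pow' (x : GaussianInt) (n : ℕ) : (x ^ n).norm = x.norm ^ n :=
  map_pow (Zsqrtd.normMonoidHom (d := -1)) x n

/-- An element of norm `p ^ n` prime to a prime `π` of norm `p` is associated with the power of
the conjugate of `π`. -/
theorem associated_star_pow {p : ℕ} (hp : p.Prime) {π x : GaussianInt} (hπ : π.norm = p) {n : ℕ}
    (hx : x.norm = (p : ℤ) ^ n) (h : ¬ π ∣ x) : Associated x (star π ^ n) := by
  have hc : IsCoprime x (π ^ n) :=
    (((prime_of_norm_eq_prime hp hπ).coprime_iff_not_dvd).2 h).symm.pow_right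
  refine associated_of_dvd_of_norm_eq (hc.dvd_of_dvd_mul_left (?_ : x ∣ π ^ n * star π ^ n)) ?_ ?_
  · rw [← mul_pow, ← Zsqrtd.norm_eq_mul_conj, hπ]
    refine ⟨star x, ?_⟩
    rw [← Zsqrtd.norm_eq_mul_conj, hx]
    push_cast; rfl
  · rw [norm_pow', Zsqrtd.norm_conj, hx, hπ]
  · rw [norm_pow', Zsqrtd.norm_conj, hπ]
    exact pow_ne_zero _ (by exact_mod_cast hp.ne_zero)

theorem associated_pow_of_norm_eq {p : ℕ} (hp : p.Prime) {π x : GaussianInt} (hπ : π.norm = p)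
    (hs : ¬ star π ∣ π) {n : ℕ} (hx : x.norm = (p : ℤ) ^ n) (h : ¬ (p : GaussianInt) ∣ x) :
    Associated x (π ^ n) ∨ Associated x (star π ^ n) := by
  by_cases h1 : π ∣ x
  · left
    have hπ' : (star π).norm = p := by rw [Zsqrtd.norm_conj, hπ]
    -- The roles of π and its conjugate are exchanged: if both divided x, so would their product p.
    have := associated_star_pow hp hπ' hx (fun h2 => h ?_)
    · rwa [star_star] at this
    · obtain ⟨y, rfl⟩ := h1
      obtain ⟨w, rfl⟩ := ((prime_of_norm_eq_prime hp hπ').dvd_mul.1 h2).resolve_left hs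
      refine ⟨w, ?_⟩
      rw [← mul_assoc, ← Zsqrtd.norm_eq_mul_conj, hπ]
      push_cast; rfl
  · exact Or.inr (associated_star_pow hp hπ hx h1)

theorem associated_star {x y : GaussianInt} (h : Associated x y) : Associated (star x) (star y) :=
  h.map (starRingEnd GaussianInt)

/-- Up to units and conjugation, there is only one Gaussian integer of norm `p ^ (2 * m)` that is
not divisible by `p`. -/
theorem associated_pow_or_associated_star_pow {p : ℕ} (hp : p.Prime) (h4 : p ≡ 1 [MOD 4])
    {x z : GaussianInt} {m : ℕ} (hz : z.norm = (p : ℤ) ^ 2) (hpz : ¬ (p : GaussianInt) ∣ z)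
    (hx : x.norm = (p : ℤ) ^ (2 * m)) (hpx : ¬ (p : GaussianInt) ∣ x) :
    Associated x (z ^ m) ∨ Associated x (star z ^ m) := by
  obtain ⟨π, hπ, hs⟩ := exists_prime_norm_eq hp h4
  have e1 := associated_pow_of_norm_eq hp hπ hs hz hpz
  have e2 := associated_pow_of_norm_eq hp hπ hs hx hpx
  rw [pow_mul, pow_mul] at e2
  rcases e1 with e1 | e1
  · have e1' := associated_star e1
    rw [star_pow] at e1'
    exact e2.imp (fun e => e.trans (e1.pow_pow).symm) (fun e => e.trans (e1'.pow_pow).symm)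
  · have e1' := associated_star e1
    rw [star_pow, star_star] at e1'
    exact e2.symm.imp (fun e => e.trans (e1.pow_pow).symm) (fun e => e.trans (e1'.pow_pow).symm)

/-- The norm of u + 1 is 2 Re u + 2, at most 4 for a unit, while 2 - 2i has norm 8; hence the norm
is 0. This congruence is what fixes the unit in the value of the Jacobi sum. -/
theorem eq_neg_one_of_isUnit {u v : GaussianInt} (hu : IsUnit u) (h : u + 1 = 2 * ⟨1, -1⟩ * v) :
    u = -1 := by
  have h1 := (Zsqrtd.norm_eq_one_iff' (by norm_num) u).2 hu
  have h2 := congrArg Zsqrtd.norm h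
  simp only [Zsqrtd.norm_mul] at h2
  simp only [Zsqrtd.norm_def, Zsqrtd.re_add, Zsqrtd.im_add, Zsqrtd.re_one, Zsqrtd.im_one,
    Zsqrtd.re_ofNat, Zsqrtd.im_ofNat] at h1 h2
  have h3 : u.re ≤ 1 := by nlinarith [sq_nonneg u.im]
  have h3' : -1 ≤ u.re := by nlinarith [sq_nonneg u.im]
  have h4 : 2 * u.re + 2 = 8 * (v.re * v.re - -1 * v.im * v.im) := by
    push_cast at h2; linarith
  have h5 : u.re = -1 := by omega
  have h6 : u.im = 0 := by
    rw [h5] at h1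
    have : u.im * u.im = 0 := by linarith
    exact mul_self_eq_zero.1 this
  ext <;> simp [h5, h6]

/-! ### Base solutions and their powers -/

/-- The Gaussian integer `c₁ + 2 d₁ i`. -/
def baseElt (c d : ℤ) : GaussianInt := ⟨c, 2 * d⟩

theorem norm_baseElt {p : ℕ} {c d : ℤ} (h : IsBaseSolution p c d) :
    (baseElt c d).norm = (p : ℤ) ^ 2 := by
  rw [h.1, Zsqrtd.norm_def, baseElt]; ring

theorem IsBaseSolution.not_dvd {p : ℕ} (hp : p.Prime) {c d : ℤ} (h : IsBaseSolution p c d) :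
    ¬ (p : ℤ) ∣ c := fun h' =>
  (Nat.prime_iff_prime_int.1 hp).not_isUnit (h.2.2.isUnit_of_dvd' h' dvd_rfl)

theorem not_dvd_baseElt {p : ℕ} (hp : p.Prime) {c d : ℤ} (h : IsBaseSolution p c d) :
    ¬ (p : GaussianInt) ∣ baseElt c d := fun h' =>
  h.not_dvd hp ((natCast_dvd_iff_re_im _ _).1 h').1

/-- Odd squares are 1 modulo 8, so 8 divides p² - c² = 4d². With d even, c + 2di is 1 modulo 4, not
only modulo 2. -/
theorem IsBaseSolution.even {p : ℕ} (h4 : p ≡ 1 [MOD 4]) {c d : ℤ} (h : IsBaseSolution p c d) :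
    ∃ e, d = 2 * e := by
  have hp : (p : ℤ) % 4 = 1 := by have : p % 4 = 1 := h4; omega
  have hc : c % 4 = 1 := h.2.1
  obtain ⟨a, ha⟩ : ∃ a, (p : ℤ) = 4 * a + 1 := ⟨p / 4, by omega⟩
  obtain ⟨b, hb⟩ : ∃ b, c = 4 * b + 1 := ⟨c / 4, by omega⟩
  have h1 := h.1
  rw [ha, hb] at h1
  rcases Int.even_or_odd' d with ⟨e, rfl | rfl⟩
  · exact ⟨e, rfl⟩
  · have : 4 * (4 * a ^ 2 + 2 * a) = 4 * (4 * b ^ 2 + 2 * b + 4 * e ^ 2 + 4 * e + 1) := by linarith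
    have := mul_left_cancel₀ (by norm_num : (4 : ℤ) ≠ 0) this
    omega

/-- The powers of a base solution are congruent to `1` modulo `4`. -/
theorem four_dvd_baseElt_pow_sub_one {p : ℕ} (h4 : p ≡ 1 [MOD 4]) {c d : ℤ}
    (h : IsBaseSolution p c d) (n : ℕ) : (4 : GaussianInt) ∣ baseElt c d ^ n - 1 := by
  obtain ⟨e, rfl⟩ := h.even h4
  have hc : c % 4 = 1 := h.2.1
  obtain ⟨b, rfl⟩ : ∃ b, c = 4 * b + 1 := ⟨c / 4, by omega⟩
  have : (4 : GaussianInt) ∣ baseElt (4 * b + 1) (2 * e) - 1 :=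
    ⟨⟨b, e⟩, by ext <;> simp [baseElt]; ring⟩
  exact this.trans (by simpa using sub_dvd_pow_sub_pow (baseElt (4 * b + 1) (2 * e)) 1 n)

/-- A Gaussian integer of norm `p ^ (4 * l)` that is congruent to `-1` modulo `2 + 2i` and not
divisible by `p` is minus the power of a base solution or of its conjugate. -/
theorem eq_neg_pow_of_congr {p : ℕ} (hp : p.Prime) (h4 : p ≡ 1 [MOD 4]) {c d : ℤ}
    (h : IsBaseSolution p c d) {x v : GaussianInt} {l : ℕ} (hx : x.norm = (p : ℤ) ^ (4 * l))
    (hpx : ¬ (p : GaussianInt) ∣ x) (hv : x + 1 = 2 * ⟨1, -1⟩ * v) :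
    x = -(baseElt c d) ^ (2 * l) ∨ x = -(star (baseElt c d)) ^ (2 * l) := by
  -- Write x = wu with u a unit. As 4 = (2 - 2i)(1 + i) divides w - 1, the congruence for x passes
  -- to u, so u = -1.
  have key : ∀ w : GaussianInt, 4 ∣ w - 1 → Associated x w → x = -w := by
    rintro w ⟨t, ht⟩ hw
    obtain ⟨u, rfl⟩ := hw.symm
    have : (u : GaussianInt) + 1 = 2 * ⟨1, -1⟩ * (v - ⟨1, 1⟩ * t * u) := by
      have e4 : (2 * ⟨1, -1⟩ * ⟨1, 1⟩ : GaussianInt) = 4 := by ext <;> simp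
      rw [mul_sub, ← hv, ← mul_assoc, ← mul_assoc, e4, ← ht]; ring
    rw [eq_neg_one_of_isUnit u.isUnit this]; ring
  have e : 4 * l = 2 * (2 * l) := by ring
  rw [e] at hx
  refine (associated_pow_or_associated_star_pow hp h4 (norm_baseElt h) (not_dvd_baseElt hp h) hx
    hpx).imp (key _ (four_dvd_baseElt_pow_sub_one h4 h _)) (key _ ?_)
  have := map_dvd (starRingEnd GaussianInt) (four_dvd_baseElt_pow_sub_one h4 h (2 * l))
  rwa [map_sub, map_pow, map_one, map_ofNat, starRingEnd_apply] at this

theorem exists_isBaseSolution {p : ℕ} (hp : p.Prime) (h4 : p ≡ 1 [MOD 4]) :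
    ∃ c d, IsBaseSolution p c d := by
  have := Fact.mk hp
  have h4' : p % 4 = 1 := h4
  obtain ⟨a, b, hab⟩ := Nat.Prime.sq_add_sq (p := p) (by omega)
  have key : ∀ s t : ℕ, s ^ 2 + (2 * t) ^ 2 = p → ∃ c d, IsBaseSolution p c d := by
    intro s t hst
    have hs : ((s : ℤ) ^ 2) % 4 = 1 := by
      have : (s : ℤ) ^ 2 + 4 * (t : ℤ) ^ 2 = p := by rw [← hst]; push_cast; ring
      omega
    -- These are the real part and half the imaginary part of (s + 2ti)², whose norm is p².
    refine ⟨(s : ℤ) ^ 2 - (2 * t) ^ 2, s * (2 * t), ?_, ?_, ?_⟩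
    · rw [← hst]; push_cast; ring
    · change _ % _ = _ % _
      have : (s : ℤ) ^ 2 - (2 * t) ^ 2 = (s : ℤ) ^ 2 - 4 * (t : ℤ) ^ 2 := by ring
      omega
    · refine ((Nat.prime_iff_prime_int.1 hp).coprime_iff_not_dvd.2 fun h => ?_).symm
      have h1 : (p : ℤ) ∣ (s ^ 2 - (2 * t) ^ 2) + p := dvd_add h dvd_rfl
      have h2 : (((s : ℤ) ^ 2 - (2 * t) ^ 2) + p) = ((2 * s ^ 2 : ℕ) : ℤ) := by
        rw [← hst]; push_cast; ring
      rw [h2, Int.natCast_dvd_natCast] at h1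
      have h3 : p ∣ s := by
        rcases hp.dvd_mul.1 h1 with h | h
        · have := (Nat.prime_dvd_prime_iff_eq hp Nat.prime_two).1 h
          omega
        · exact hp.dvd_of_dvd_pow h
      have h5 : 0 < s := by
        rcases Nat.eq_zero_or_pos s with rfl | h; · simp at hs
        exact h
      have h6 := Nat.le_of_dvd h5 h3
      nlinarith [hp.one_lt]
  rcases Nat.even_or_odd' a with ⟨s, rfl | rfl⟩
  · exact key b s (by rw [add_comm]; exact hab)
  · rcases Nat.even_or_odd' b with ⟨t, rfl | rfl⟩
    · exact key _ t hab
    · exfalso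
      have : p = 4 * (s ^ 2 + s + t ^ 2 + t) + 2 := by rw [← hab]; ring
      omega

/-! ### Integrality of `cSeq` and `2 * dSeq`, and distinctness of the eigenvalues -/

theorem cSeq_eq (c d : ℤ) (l : ℕ) : cSeq c d l = ((baseElt c d ^ l).re : ℂ) := by
  have e1 : (c : ℂ) + 2 * d * Complex.I = toComplex (baseElt c d) := by
    simp [baseElt, toComplex_def]
  have e2 : (c : ℂ) - 2 * d * Complex.I = toComplex (star (baseElt c d)) := by
    simp [baseElt, toComplex_def]; ring
  rw [cSeq, e1, e2, ← map_pow, ← map_pow, ← star_pow]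
  simp only [toComplex_def, Zsqrtd.re_star, Zsqrtd.im_star]
  push_cast
  ring

theorem two_mul_dSeq_eq (c d : ℤ) (l : ℕ) : 2 * dSeq c d l = ((baseElt c d ^ l).im : ℂ) := by
  have e1 : (c : ℂ) + 2 * d * Complex.I = toComplex (baseElt c d) := by
    simp [baseElt, toComplex_def]
  have e2 : (c : ℂ) - 2 * d * Complex.I = toComplex (star (baseElt c d)) := by
    simp [baseElt, toComplex_def]; ring
  rw [dSeq, e1, e2, ← map_pow, ← map_pow, ← star_pow]
  simp only [toComplex_def, Zsqrtd.re_star, Zsqrtd.im_star]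
  push_cast
  linear_combination (-((baseElt c d ^ l).im : ℂ)) * Complex.I_mul_I

/-- From z² = 2cz - p², passing to the next power multiplies the real part by 2c modulo p, and p
does not divide 2c. -/
theorem not_dvd_re_baseElt_pow {p : ℕ} (hp : p.Prime) (h4 : p ≡ 1 [MOD 4]) {c d : ℤ}
    (h : IsBaseSolution p c d) (n : ℕ) : ¬ (p : ℤ) ∣ (baseElt c d ^ (n + 1)).re := by
  have hpp := Nat.prime_iff_prime_int.1 hp
  induction n with
  | zero => simpa [baseElt] using h.not_dvd hp
  | succ n ih =>
    intro hd
    have e : (baseElt c d ^ (n + 2)).re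
        = 2 * c * (baseElt c d ^ (n + 1)).re - p ^ 2 * (baseElt c d ^ n).re := by
      rw [h.1, pow_succ _ (n + 1), pow_succ _ n]
      simp [baseElt]; ring
    rw [e] at hd
    have h1 := (dvd_sub_left (Dvd.dvd.mul_right (dvd_pow_self _ two_ne_zero) _)).1 hd
    rcases hpp.dvd_or_dvd h1 with h2 | h2
    · rcases hpp.dvd_or_dvd h2 with h3 | h3
      · have := (Nat.prime_dvd_prime_iff_eq hp Nat.prime_two).1 (by exact_mod_cast h3)
        subst this; exact absurd h4 (by decide)
      · exact h.not_dvd hp h3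
    · exact ih h2

/-- The five eigenvalues listed in the theorem are distinct. -/
theorem nodup_eigenvalues {p : ℕ} (hp : p.Prime) (h4 : p ≡ 1 [MOD 4]) {c d : ℤ}
    (h : IsBaseSolution p c d) {l : ℕ} (hl : 1 ≤ l) :
    ((nSeq p l : ℂ) :: nonPrincipal p l (cSeq c d l) (dSeq c d l)).Nodup := by
  obtain ⟨n, rfl⟩ : ∃ n, l = n + 1 := ⟨l - 1, by omega⟩
  have hre := not_dvd_re_baseElt_pow hp h4 h n
  have hc := cSeq_eq c d (n + 1)
  have hd := two_mul_dSeq_eq c d (n + 1)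
  have hN : (baseElt c d ^ (n + 1)).norm = ((p : ℤ) ^ (n + 1)) ^ 2 := by
    rw [norm_pow', norm_baseElt h]; ring
  rw [Zsqrtd.norm_def] at hN
  set C := (baseElt c d ^ (n + 1)).re
  set D := (baseElt c d ^ (n + 1)).im
  set P : ℤ := (p : ℤ) ^ (n + 1) with hP
  have hP5 : 5 ≤ P := by
    have : 5 ≤ p := by
      have := hp.two_le; have h4' : p % 4 = 1 := h4; omega
    calc (5 : ℤ) ≤ p := by exact_mod_cast this
      _ = (p : ℤ) ^ 1 := by ring
      _ ≤ P := pow_le_pow_right₀ (by exact_mod_cast hp.one_le) (by omega)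
  have hpP : (p : ℤ) ∣ P := dvd_pow_self _ (by omega)
  have hC0 : C ≠ 0 := fun h0 => hre (h0 ▸ dvd_zero _)
  -- D = 0 would give C² = P², making C divisible by p.
  have hD0 : D ≠ 0 := fun h0 => by
    have : C ^ 2 = P ^ 2 := by rw [h0] at hN; linarith
    exact hre ((Nat.prime_iff_prime_int.1 hp).dvd_of_dvd_pow (this ▸ dvd_pow hpP two_ne_zero))
  have hn4 : (4 * nSeq p (n + 1) : ℤ) = P ^ 4 - 1 := by
    have h1 : 4 ∣ p ^ (4 * (n + 1)) - 1 := by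
      have : p ^ (4 * (n + 1)) ≡ 1 [MOD 4] := by simpa using h4.pow (4 * (n + 1))
      exact (Nat.modEq_iff_dvd' (Nat.one_le_pow _ _ hp.pos)).1 this.symm
    have h2 : 4 * nSeq p (n + 1) = p ^ (4 * (n + 1)) - 1 := Nat.mul_div_cancel' h1
    have h3 : (4 * nSeq p (n + 1) + 1 : ℕ) = p ^ (4 * (n + 1)) := by
      rw [h2]; exact Nat.sub_add_cancel (Nat.one_le_pow _ _ hp.pos)
    have h4 : (4 * nSeq p (n + 1) + 1 : ℤ) = (p : ℤ) ^ (4 * (n + 1)) := by exact_mod_cast h3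
    rw [hP, ← pow_mul, mul_comm (n + 1) 4]; linarith
  have e0 : (nSeq p (n + 1) : ℂ) = (((P ^ 4 - 1 : ℤ) : ℂ)) / 4 := by
    rw [← hn4]; push_cast; ring
  have ePc : (p : ℂ) ^ (n + 1) = (P : ℂ) := by rw [hP]; push_cast; rfl
  have e1 : nonPrincipal p (n + 1) (cSeq c d (n + 1)) (dSeq c d (n + 1)) =
      [((P ^ 2 + 2 * D * P - 1 : ℤ) : ℂ) / 4, ((P ^ 2 - 2 * D * P - 1 : ℤ) : ℂ) / 4,
        ((-P ^ 2 + 2 * C * P - 1 : ℤ) : ℂ) / 4, ((-P ^ 2 - 2 * C * P - 1 : ℤ) : ℂ) / 4] := by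
    have e4 : 4 * dSeq c d (n + 1) = 2 * D := by linear_combination 2 * hd
    rw [nonPrincipal, pow_mul', ePc, e4, hc]
    push_cast
    rfl
  have hinj : Function.Injective fun k : ℤ => (k : ℂ) / 4 := fun a b hab => by
    have : (a : ℂ) = b := by
      have := congrArg (· * 4) hab
      simpa using this
    exact_mod_cast this
  have hP0 : P ≠ 0 := by omega
  have hCb : C ≤ P ∧ -P ≤ C := abs_le_of_sq_le_sq' (by nlinarith [sq_nonneg D]) (by omega) |>.symm
  have hDb : D ≤ P ∧ -P ≤ D := abs_le_of_sq_le_sq' (by nlinarith [sq_nonneg C]) (by omega) |>.symm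
  have hP4 : 3 * P ^ 2 < P ^ 4 := by
    have : 25 ≤ P ^ 2 := by nlinarith
    nlinarith
  have hPD : P * D ≤ P ^ 2 ∧ -P ^ 2 ≤ P * D := ⟨by nlinarith, by nlinarith⟩
  have hPC : P * C ≤ P ^ 2 ∧ -P ^ 2 ≤ P * C := ⟨by nlinarith, by nlinarith⟩
  -- An equality gives P = C' - D'; together with P² = C'² + D'² this forces C'D' = 0. The primes
  -- absorb all choices of sign.
  have cross : ∀ C' D' : ℤ, C' ^ 2 = C ^ 2 → D' ^ 2 = D ^ 2 →
      P ^ 2 + 2 * D' * P - 1 ≠ -P ^ 2 + 2 * C' * P - 1 := by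
    intro C' D' h1 h2 h3
    have h5 : (2 * P) * P = (2 * P) * (C' - D') := by linarith
    have h6 := mul_left_cancel₀ (by omega) h5
    have h7 : C' * D' = 0 := by
      have : P ^ 2 = (C' - D') ^ 2 := by rw [← h6]
      nlinarith
    rcases mul_eq_zero.1 h7 with h | h
    · rw [h] at h1; exact hC0 (pow_eq_zero_iff two_ne_zero |>.1 (by rw [← h1]; norm_num))
    · rw [h] at h2; exact hD0 (pow_eq_zero_iff two_ne_zero |>.1 (by rw [← h2]; norm_num))
  rw [e0, e1]
  change (List.map (fun k : ℤ => (k : ℂ) / 4) [P ^ 4 - 1, P ^ 2 + 2 * D * P - 1,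
    P ^ 2 - 2 * D * P - 1, -P ^ 2 + 2 * C * P - 1, -P ^ 2 - 2 * C * P - 1]).Nodup
  refine List.Nodup.map hinj ?_
  have x1 := cross C D rfl rfl
  have x2 := cross (-C) D (by ring) rfl
  have x3 := cross C (-D) rfl (by ring)
  have x4 := cross (-C) (-D) (by ring) (by ring)
  have hDP : D * P ≠ 0 := mul_ne_zero hD0 hP0
  have hCP : C * P ≠ 0 := mul_ne_zero hC0 hP0
  simp only [List.nodup_cons, List.mem_cons, List.not_mem_nil, or_false, not_or,
    not_false_eq_true, List.nodup_nil, and_true]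
  have hP2 : 0 < P ^ 2 := by positivity
  refine ⟨⟨?_, ?_, ?_, ?_⟩, ⟨?_, ?_, ?_⟩, ⟨?_, ?_⟩, ?_⟩ <;> intro h0
  · nlinarith
  · nlinarith
  · nlinarith
  · nlinarith
  · exact hDP (by linarith)
  · exact x1 h0
  · exact x2 (by linarith)
  · exact x3 (by linarith)
  · exact x4 (by linarith)
  · exact hCP (by linarith)

/-! ### Spectra of Cayley digraphs of a finite field -/

open Classical in
/-- The eigenvalues of a Cayley digraph of the additive group of a finite field are the character
sums over the connection set. -/
theorem spec_cayleyDigraph {F : Type*} [Field F] [Fintype F] {ψ : AddChar F ℂ}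
    (hψ : ψ.IsPrimitive) (S : Set F) :
    spec (cayleyDigraph S) = Finset.univ.val.map fun a : F => ∑ s, if s ∈ S then ψ (s * a) else 0 := by
  set lam : F → ℂ := fun a => ∑ s, if s ∈ S then ψ (s * a) else 0 with hlam
  -- The columns of P are additive characters, hence eigenvectors; Q inverts P by orthogonality,
  -- where primitivity of ψ enters.
  set P : Matrix F F ℂ := Matrix.of fun v a => ψ (v * a) with hP
  set Q : Matrix F F ℂ := Matrix.of fun a v => (Fintype.card F : ℂ)⁻¹ * ψ (-(a * v)) with hQ
  have hq : (Fintype.card F : ℂ) ≠ 0 := by exact_mod_cast Fintype.card_ne_zero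
  have hPQ : P * Q = 1 := by
    ext v w
    have e : ∀ a, P v a * Q a w = (Fintype.card F : ℂ)⁻¹ * ψ (a * (v - w)) := fun a => by
      rw [hP, hQ, Matrix.of_apply, Matrix.of_apply, mul_left_comm, ← AddChar.map_add_eq_mul]
      congr 2
      ring
    rw [Matrix.mul_apply, Finset.sum_congr rfl fun a _ => e a, ← Finset.mul_sum,
      AddChar.sum_mulShift _ hψ, Matrix.one_apply]
    simp only [sub_eq_zero]
    split_ifs <;> simp [hq]
  have hQP : Q * P = 1 := mul_eq_one_comm.1 hPQ
  have hAP : adjMatrix (cayleyDigraph S) * P = P * Matrix.diagonal lam := by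
    ext v a
    rw [Matrix.mul_diagonal, Matrix.mul_apply, hlam, Finset.mul_sum,
      ← Equiv.sum_comp (Equiv.addLeft v)]
    refine Finset.sum_congr rfl fun s _ => ?_
    simp only [adjMatrix, cayleyDigraph, hP, Matrix.of_apply, Equiv.coe_addLeft,
      add_sub_cancel_left]
    split_ifs
    · rw [one_mul, add_mul, AddChar.map_add_eq_mul]
    · simp
  have hA : adjMatrix (cayleyDigraph S) = P * Matrix.diagonal lam * Q := by
    rw [← hAP, mul_assoc, hPQ, mul_one]
  have hc := Matrix.charpoly_units_conj (⟨P, Q, hPQ, hQP⟩ : (Matrix F F ℂ)ˣ) (Matrix.diagonal lam)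
  rw [show ((⟨P, Q, hPQ, hQP⟩ : (Matrix F F ℂ)ˣ) : Matrix F F ℂ) = P from rfl,
    Matrix.inv_eq_right_inv hPQ] at hc
  rw [spec, hA, hc, Matrix.charpoly_diagonal,
    ← Polynomial.roots_multiset_prod_X_sub_C (Finset.univ.val.map lam),
    Multiset.map_map]
  rfl

/-! ### Quartic characters with Gaussian integer values, and their Jacobi sum -/

/-- The imaginary unit of the Gaussian integers. -/
def gaussI : GaussianInt := ⟨0, 1⟩

theorem gaussI_mul_self : gaussI * gaussI = -1 := by
  ext <;> simp [gaussI]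

theorem gaussI_sq : gaussI ^ 2 = -1 := by rw [sq, gaussI_mul_self]

theorem gaussI_pow_four : gaussI ^ 4 = 1 := by
  rw [show 4 = 2 * 2 from rfl, pow_mul, gaussI_sq]; norm_num

theorem toComplex_gaussI : toComplex gaussI = Complex.I := by simp [toComplex_def, gaussI]

theorem gaussI_pow_eq_one_iff {k : ℕ} : gaussI ^ k = 1 ↔ 4 ∣ k := by
  constructor
  · intro h
    have e : gaussI ^ k = gaussI ^ (k % 4) := by
      conv_lhs => rw [← Nat.div_add_mod k 4, pow_add, pow_mul, gaussI_pow_four, one_pow, one_mul]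
    rw [e] at h
    have hlt := Nat.mod_lt k (show 0 < 4 by norm_num)
    refine Nat.dvd_of_mod_eq_zero ?_
    revert h hlt
    generalize k % 4 = r
    intro h hlt
    interval_cases r
    · rfl
    · exact absurd h (by decide)
    · exact absurd h (by decide)
    · exact absurd h (by decide)
  · rintro ⟨t, rfl⟩
    rw [pow_mul, gaussI_pow_four, one_pow]

/-- The central binomial coefficient of `(p ^ r - 1) / 2` is prime to `p`. -/
theorem not_dvd_choose {p : ℕ} (hp : p.Prime) (h4 : p ≡ 1 [MOD 4]) (r : ℕ) :
    ∀ m : ℕ, p ^ r = 4 * m + 1 → ¬ p ∣ (2 * m).choose m := by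
  have := Fact.mk hp
  have h4' : p % 4 = 1 := h4
  obtain ⟨t, ht⟩ : ∃ t, p = 4 * t + 1 := ⟨p / 4, by omega⟩
  have hp2 := hp.two_le
  induction r with
  | zero =>
    intro m hm
    obtain rfl : m = 0 := by simpa using hm.symm
    simpa using hp.one_lt.ne'
  | succ r ih =>
    intro m hm
    have h1 : p ^ r % 4 = 1 := by
      have : p ^ r ≡ 1 ^ r [MOD 4] := h4.pow r
      rwa [one_pow] at this
    obtain ⟨s, hs⟩ : ∃ s, p ^ r = 4 * s + 1 := ⟨p ^ r / 4, by omega⟩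
    have hms : m = t + p * s := by
      rw [pow_succ, hs] at hm
      have : 4 * m + 1 = 4 * (t + p * s) + 1 := by rw [← hm]; linarith
      omega
    -- Lucas' congruence: the last base-p digits of m and 2m are t = (p - 1)/4 and 2t < p, so a
    -- factor C(2t, t) prime to p splits off, and s takes the place of m.
    have hC := Choose.choose_modEq_choose_mod_mul_choose_div_nat (n := 2 * m) (k := m) (p := p)
    have e1 : 2 * m = 2 * t + p * (2 * s) := by rw [hms]; ring
    rw [e1, hms, Nat.add_mul_mod_self_left, Nat.add_mul_mod_self_left,
      Nat.add_mul_div_left _ _ hp.pos, Nat.add_mul_div_left _ _ hp.pos,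
      Nat.mod_eq_of_lt (by omega : 2 * t < p), Nat.mod_eq_of_lt (by omega : t < p),
      Nat.div_eq_of_lt (by omega : 2 * t < p), Nat.div_eq_of_lt (by omega : t < p), zero_add,
      zero_add] at hC
    rw [e1, hms]
    intro hd
    rcases hp.dvd_mul.1 ((hC.dvd_iff dvd_rfl).1 hd) with h | h
    · have h2 : (2 * t).choose t ∣ (2 * t).factorial := by
        have := Nat.choose_mul_factorial_mul_factorial (show t ≤ 2 * t by omega)
        exact ⟨_, by rw [← this, mul_assoc]⟩
      have := (hp.dvd_factorial).1 (h.trans h2)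
      omega
    · exact ih s hs h

section Characters

variable {F : Type*} [Field F]

section

variable {g : Fˣ} {χ : MulChar F GaussianInt}

theorem mulChar_generator_pow (hχ : χ g = gaussI) (k : ℕ) : χ ((g : F) ^ k) = gaussI ^ k := by
  rw [map_pow, hχ]

theorem quartic_ne_one (hχ : χ g = gaussI) : χ ≠ 1 := fun h => by
  rw [h, MulChar.one_apply_coe] at hχ; exact absurd hχ (by decide)

theorem quartic_sq_ne_one (hχ : χ g = gaussI) : χ ^ 2 ≠ 1 := fun h => by
  have : (χ ^ 2) g = -1 := by rw [MulChar.pow_apply_coe, hχ, gaussI_sq]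
  rw [h, MulChar.one_apply_coe] at this; exact absurd this (by decide)

theorem quartic_cube_ne_one (hχ : χ g = gaussI) : χ ^ 3 ≠ 1 := fun h => by
  have : (χ ^ 3) g = gaussI ^ 3 := by rw [MulChar.pow_apply_coe, hχ]
  rw [h, MulChar.one_apply_coe] at this; exact absurd this (by decide)

/-- The complex-valued character attached to a character with values in the Gaussian integers. -/
noncomputable def complexChar (χ : MulChar F GaussianInt) : MulChar F ℂ :=
  χ.ringHomComp toComplex

theorem complexChar_pow_ne_one {n : ℕ} (h : χ ^ n ≠ 1) : complexChar χ ^ n ≠ 1 := by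
  rw [complexChar, MulChar.ringHomComp_pow]
  exact (MulChar.ringHomComp_ne_one_iff toComplex_injective).2 h

theorem complexChar_generator_pow (hχ : χ g = gaussI) (k : ℕ) :
    complexChar χ ((g : F) ^ k) = Complex.I ^ k := by
  rw [complexChar, MulChar.ringHomComp_apply, mulChar_generator_pow hχ, map_pow, toComplex_gaussI]

theorem complexChar_ne_one (hχ : χ g = gaussI) : complexChar χ ≠ 1 := by
  have := complexChar_pow_ne_one (χ := χ) (n := 1) (by rw [pow_one]; exact quartic_ne_one hχ)
  rwa [pow_one] at this

end

variable [Fintype F]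

/-- There is a character that sends a given generator of the unit group to `i`. -/
theorem exists_quartic_mulChar {m : ℕ} (hF : Fintype.card F = 4 * m + 1) {g : Fˣ}
    (hg : ∀ x, x ∈ Subgroup.zpowers g) : ∃ χ : MulChar F GaussianInt, χ g = gaussI := by
  classical
  have h1 : gaussI * -gaussI = 1 := by rw [mul_neg, gaussI_mul_self, neg_neg]
  let u : GaussianIntˣ := ⟨gaussI, -gaussI, h1, by rw [mul_comm]; exact h1⟩
  have hu : u ∈ rootsOfUnity (Fintype.card Fˣ) GaussianInt := by
    rw [mem_rootsOfUnity, Fintype.card_units, hF]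
    ext1
    simp [u, pow_mul, gaussI_pow_four]
  exact ⟨MulChar.ofRootOfUnity hu hg, MulChar.ofRootOfUnity_spec hu hg⟩

theorem exists_pow_eq {g : Fˣ} (hg : ∀ x, x ∈ Subgroup.zpowers g) {x : F} (hx : x ≠ 0) :
    ∃ k : ℕ, x = (g : F) ^ k := by
  obtain ⟨k, hk⟩ := (isOfFinOrder_of_finite g).mem_powers_iff_mem_zpowers.2 (hg (Units.mk0 x hx))
  exact ⟨k, by simpa using (congrArg Units.val hk).symm⟩

theorem pow_card_sub_one {m : ℕ} (hF : Fintype.card F = 4 * m + 1) {x : F} (hx : x ≠ 0) :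
    x ^ (4 * m) = 1 := by
  have := FiniteField.pow_card_sub_one_eq_one x hx
  rwa [hF, Nat.add_sub_cancel] at this

theorem orderOf_generator {m : ℕ} (hF : Fintype.card F = 4 * m + 1) {g : Fˣ}
    (hg : ∀ x, x ∈ Subgroup.zpowers g) : orderOf g = 4 * m := by
  classical
  rw [orderOf_eq_card_of_forall_mem_zpowers hg, Nat.card_eq_fintype_card, Fintype.card_units, hF,
    Nat.add_sub_cancel]

/-- Power sums over a finite field. -/
theorem sum_pow_eq [DecidableEq F] {m : ℕ} (hF : Fintype.card F = 4 * m + 1) {i : ℕ} (hi : 0 < i) :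
    ∑ x : F, x ^ i = if 4 * m ∣ i then -1 else 0 := by
  have h := FiniteField.sum_pow_units F i
  rw [hF, Nat.add_sub_cancel] at h
  rw [← h, ← Finset.sum_erase (f := fun x : F => x ^ i) (a := (0 : F)) Finset.univ (zero_pow hi.ne')]
  refine (Finset.sum_bij (fun (u : Fˣ) _ => (u : F)) ?_ ?_ ?_ ?_).symm
  · intro u _; simp
  · intro u _ v _ huv; exact Units.ext huv
  · intro b hb
    exact ⟨Units.mk0 b (Finset.ne_of_mem_erase hb), Finset.mem_univ _, rfl⟩
  · intro u _; rfl

/-- After binomial expansion, the power sum with exponent 3m + j, 0 ≤ j ≤ 2m, survives only if 4m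
divides 3m + j, that is, for j = m. The left side is the image in F of the Jacobi sum. -/
theorem sum_pow_mul_one_sub_pow {m : ℕ} (hm : 0 < m) (hF : Fintype.card F = 4 * m + 1) :
    ∑ x : F, x ^ (3 * m) * (1 - x) ^ (2 * m) = -((-1) ^ m * ((2 * m).choose m : F)) := by
  classical
  have e : ∀ x : F, x ^ (3 * m) * (1 - x) ^ (2 * m) =
      ∑ j ∈ Finset.range (2 * m + 1), (-1) ^ j * ((2 * m).choose j : F) * x ^ (3 * m + j) := by
    intro x
    rw [show (1 - x) = -x + 1 by ring, add_pow, Finset.mul_sum]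
    refine Finset.sum_congr rfl fun j _ => ?_
    rw [neg_pow, one_pow, pow_add]; ring
  rw [Finset.sum_congr rfl fun x _ => e x, Finset.sum_comm, Finset.sum_eq_single m]
  · rw [← Finset.mul_sum, sum_pow_eq hF (by omega), if_pos ⟨1, by ring⟩]; ring
  · intro j hj hjm
    rw [← Finset.mul_sum, sum_pow_eq hF (by omega), if_neg, mul_zero]
    rintro ⟨t, ht⟩
    have hj' := Finset.mem_range.1 hj
    have h1 : t = 1 := by
      have h2 : 0 < t := Nat.pos_of_ne_zero (by rintro rfl; omega)
      have h3 : t < 2 := by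
        by_contra h3
        have : 4 * m * 2 ≤ 4 * m * t := Nat.mul_le_mul_left _ (by omega)
        omega
      omega
    subst h1; omega
  · intro h; exact absurd (Finset.mem_range.2 (by omega)) h

variable {g : Fˣ} {χ : MulChar F GaussianInt}

/-- The Jacobi sum of a quartic character and its square is `-1` modulo `2 + 2i`. -/
theorem exists_jacobiSum_add_one_eq {m : ℕ} (hF : Fintype.card F = 4 * m + 1)
    (hg : ∀ x, x ∈ Subgroup.zpowers g) (hχ : χ g = gaussI) :
    ∃ v, jacobiSum χ (χ ^ 2) + 1 = 2 * ⟨1, -1⟩ * v := by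
  -- By orthogonality this sum is J + q. For x ≠ 0, 1 its factors are divisible by 1 - i and by 2;
  -- the terms at 0 and 1 vanish. The summand 4m of q is itself a multiple of 2 - 2i.
  have hsum : ∑ x : F, (χ x - 1) * ((χ ^ 2) (1 - x) - 1)
      = jacobiSum χ (χ ^ 2) + 4 * (m : GaussianInt) + 1 := by
    have e : ∀ x : F, (χ x - 1) * ((χ ^ 2) (1 - x) - 1)
        = χ x * (χ ^ 2) (1 - x) - χ x - (χ ^ 2) (1 - x) + 1 := fun x => by ring
    have e2 : ∑ x : F, (χ ^ 2) (1 - x) = 0 := by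
      rw [← MulChar.sum_eq_zero_of_ne_one (quartic_sq_ne_one hχ)]
      exact (Equiv.subLeft (1 : F)).sum_comp (fun x => (χ ^ 2) x)
    rw [Finset.sum_congr rfl fun x _ => e x, Finset.sum_add_distrib, Finset.sum_sub_distrib,
      Finset.sum_sub_distrib, MulChar.sum_eq_zero_of_ne_one (quartic_ne_one hχ), e2,
      Finset.sum_const, Finset.card_univ, hF, jacobiSum]
    simp; ring
  have hdvd : (2 * ⟨1, -1⟩ : GaussianInt) ∣ ∑ x : F, (χ x - 1) * ((χ ^ 2) (1 - x) - 1) := by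
    refine Finset.dvd_sum fun x _ => ?_
    rcases eq_or_ne x 0 with rfl | hx
    · simp
    rcases eq_or_ne x 1 with rfl | hx1
    · simp
    obtain ⟨k, hk⟩ := exists_pow_eq hg hx
    obtain ⟨l, hl⟩ := exists_pow_eq hg (sub_ne_zero.2 hx1.symm)
    rw [mul_comm]
    refine mul_dvd_mul ?_ ?_
    · rw [hk, mulChar_generator_pow hχ]
      refine dvd_trans ⟨-1, ?_⟩ (by simpa using sub_dvd_pow_sub_pow gaussI 1 k)
      ext <;> simp [gaussI]
    · rw [hl, MulChar.pow_apply' _ two_ne_zero, mulChar_generator_pow hχ, ← pow_mul, mul_comm,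
        pow_mul, gaussI_sq]
      refine dvd_trans ⟨-1, ?_⟩ (by simpa using sub_dvd_pow_sub_pow (-1 : GaussianInt) 1 l)
      norm_num
  rw [hsum] at hdvd
  obtain ⟨v, hv⟩ := hdvd
  refine ⟨v - ⟨1, 1⟩ * m, ?_⟩
  have e4 : (2 * ⟨1, -1⟩ * ⟨1, 1⟩ : GaussianInt) = 4 := by ext <;> simp
  rw [mul_sub, ← hv, ← mul_assoc, e4]; ring

/-- Over ℂ, conjugating J inverts both characters, and the product of the two Jacobi sums is q
because χ, χ² and χ³ are nontrivial. -/
theorem norm_jacobiSum (hχ : χ g = gaussI) :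
    (jacobiSum χ (χ ^ 2)).norm = Fintype.card F := by
  have h3 := complexChar_pow_ne_one (quartic_cube_ne_one hχ)
  rw [pow_succ'] at h3
  have hring : ringChar ℂ ≠ ringChar F := by
    rw [ringChar.eq_zero]
    exact (CharP.char_ne_zero_of_finite F (ringChar F)).symm
  have h := jacobiSum_mul_jacobiSum_inv hring (complexChar_ne_one hχ)
    (complexChar_pow_ne_one (quartic_sq_ne_one hχ)) h3
  have hJ : jacobiSum (complexChar χ) (complexChar χ ^ 2) = toComplex (jacobiSum χ (χ ^ 2)) := by
    rw [complexChar, MulChar.ringHomComp_pow, jacobiSum_ringHomComp]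
  have hs : jacobiSum (complexChar χ)⁻¹ (complexChar χ ^ 2)⁻¹
      = star (jacobiSum (complexChar χ) (complexChar χ ^ 2)) := by
    simp only [jacobiSum, star_sum, star_mul', MulChar.star_apply']
  rw [hs, hJ] at h
  have h5 : toComplex (jacobiSum χ (χ ^ 2) * star (jacobiSum χ (χ ^ 2)))
      = toComplex ((Fintype.card F : ℤ) : GaussianInt) := by
    rw [map_mul, toComplex_star]
    simpa using h
  have h6 := toComplex_injective h5
  rw [← Zsqrtd.norm_eq_mul_conj] at h6
  exact_mod_cast h6

/-- The Jacobi sum of a quartic character and its square is prime to the characteristic. -/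
theorem not_dvd_jacobiSum {p r m : ℕ} (hp : p.Prime) (h4 : p ≡ 1 [MOD 4]) (hm : 0 < m)
    (hF : Fintype.card F = 4 * m + 1) (hr : Fintype.card F = p ^ r)
    (hg : ∀ x, x ∈ Subgroup.zpowers g) (hχ : χ g = gaussI) :
    ¬ (p : GaussianInt) ∣ jacobiSum χ (χ ^ 2) := by
  intro hd
  have hg2 : ((g : F) ^ (2 * m)) = -1 := by
    have h1 : ((g : F) ^ (2 * m)) * ((g : F) ^ (2 * m)) = 1 := by
      rw [← pow_add, ← pow_card_sub_one hF g.ne_zero]; ring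
    refine (mul_self_eq_one_iff.1 h1).resolve_left fun h => ?_
    have h2 : g ^ (2 * m) = 1 := Units.ext (by simpa using h)
    have := Nat.le_of_dvd (by omega) (orderOf_dvd_of_pow_eq_one h2)
    rw [orderOf_generator hF hg] at this
    omega
  have hi : (g : F) ^ (3 * m) * (g : F) ^ (3 * m) = ((-1 : ℤ) : F) := by
    rw [← pow_add, show 3 * m + 3 * m = 4 * m + 2 * m by ring, pow_add,
      pow_card_sub_one hF g.ne_zero, hg2]; simp
  -- Reduction modulo a prime above p, turning χ into x ↦ x^(3m). The other root g^m of -1 would be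
  -- useless: x^m (1 - x)^(2m) has degree below 4m, so J would map to 0.
  let φ : GaussianInt →+* F := Zsqrtd.lift ⟨(g : F) ^ (3 * m), hi⟩
  have hφi : φ gaussI = (g : F) ^ (3 * m) := by simp [φ, gaussI, Zsqrtd.lift]
  have hφ : ∀ x : F, φ (χ x) = x ^ (3 * m) := by
    intro x
    rcases eq_or_ne x 0 with rfl | hx
    · rw [MulChar.map_zero, map_zero, zero_pow (by omega)]
    · obtain ⟨k, rfl⟩ := exists_pow_eq hg hx
      rw [mulChar_generator_pow hχ, map_pow, hφi, ← pow_mul, ← pow_mul, mul_comm]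
  have hφ2 : ∀ x : F, φ ((χ ^ 2) x) = x ^ (2 * m) := by
    intro x
    rw [MulChar.pow_apply' _ two_ne_zero, map_pow, hφ]
    rcases eq_or_ne x 0 with rfl | hx
    · rw [zero_pow (by omega), zero_pow (by omega), zero_pow (by omega)]
    · rw [← pow_mul, show 3 * m * 2 = 4 * m + 2 * m by ring, pow_add, pow_card_sub_one hF hx,
        one_mul]
  have hφJ : φ (jacobiSum χ (χ ^ 2)) = -((-1) ^ m * ((2 * m).choose m : F)) := by
    rw [jacobiSum, map_sum, ← sum_pow_mul_one_sub_pow hm hF]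
    refine Finset.sum_congr rfl fun x _ => ?_
    rw [map_mul, hφ, hφ2]
  have hp0 : (p : F) = 0 := by
    have := FiniteField.cast_card_eq_zero F
    rw [hr, Nat.cast_pow] at this
    exact eq_zero_of_pow_eq_zero this
  have := Fact.mk hp
  have : CharP F p := (CharP.charP_iff_prime_eq_zero hp).2 hp0
  obtain ⟨y, hy⟩ := hd
  rw [hy, map_mul, map_natCast, hp0, zero_mul, eq_comm, neg_eq_zero] at hφJ
  have hc := (mul_eq_zero.1 hφJ).resolve_left (pow_ne_zero _ (neg_ne_zero.2 one_ne_zero))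
  exact not_dvd_choose hp h4 r m (hr ▸ hF) ((CharP.cast_eq_zero_iff F p _).1 hc)

end Characters

/-! ### Eigenvalues as Gaussian periods -/

/-- The product of the Gauss sums of an even character and its inverse. -/
theorem gaussSum_mul_gaussSum_inv {F : Type*} [Field F] [Fintype F] {χ : MulChar F ℂ}
    (hχ : χ ≠ 1) (h1 : χ (-1) = 1) {ψ : AddChar F ℂ} (hψ : ψ.IsPrimitive) :
    gaussSum χ ψ * gaussSum χ⁻¹ ψ = Fintype.card F := by
  have h2 : χ⁻¹ (-1) = 1 := by rw [MulChar.inv_apply', inv_neg_one, h1]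
  rw [← mul_gaussSum_inv_eq_gaussSum χ⁻¹ ψ, h2, one_mul, gaussSum_mul_gaussSum_eq_card hχ hψ]

theorem map_range_four_mul {α : Type*} (m : ℕ) {f : ℕ → α} (hf : ∀ k, f (k + 4) = f k) :
    (Multiset.range (4 * m)).map f = m • ({f 0} + {f 1} + {f 2} + {f 3}) := by
  have hf' : ∀ m r, f (4 * m + r) = f r := by
    intro m r
    induction m with
    | zero => simp
    | succ m ih => rw [← ih, ← hf (4 * m + r)]; congr 1; ring
  induction m with
  | zero => simp
  | succ m ih =>
    rw [show 4 * (m + 1) = 4 * m + 1 + 1 + 1 + 1 by ring]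
    simp only [Multiset.range_succ, Multiset.map_cons, ih]
    rw [add_assoc (4 * m) 1 1, add_assoc (4 * m) _ 1, hf' m 3, hf' m 2, hf' m 1,
      show f (4 * m) = f 0 from hf' m 0, succ_nsmul]
    simp only [← Multiset.singleton_add]
    abel

section Eigenvalues

variable {F : Type*} [Field F] [Fintype F] {m : ℕ} {g : Fˣ} {χ : MulChar F GaussianInt}

theorem map_univ_eq {α : Type*} (hF : Fintype.card F = 4 * m + 1)
    (hg : ∀ x, x ∈ Subgroup.zpowers g) (f : F → α) :
    (Finset.univ : Finset F).val.map f =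
      {f 0} + (Multiset.range (4 * m)).map fun k => f ((g : F) ^ k) := by
  classical
  have h : (Finset.univ : Finset F).val
      = {0} + (Multiset.range (4 * m)).map fun k => (g : F) ^ k := by
    have hnd : ({0} + (Multiset.range (4 * m)).map fun k => (g : F) ^ k).Nodup := by
      rw [Multiset.singleton_add, Multiset.nodup_cons]
      refine ⟨?_, (Multiset.nodup_range _).map_on ?_⟩
      · rw [Multiset.mem_map]
        rintro ⟨k, -, hk⟩
        exact pow_ne_zero k g.ne_zero hk
      · intro a ha b hb hab
        rw [Multiset.mem_range, ← orderOf_generator hF hg] at ha hb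
        exact pow_injOn_Iio_orderOf ha hb (Units.ext (by simpa using hab))
    refine (Multiset.eq_of_le_of_card_le ((Multiset.le_iff_subset hnd).2 fun x _ => ?_) ?_).symm
    · exact Finset.mem_univ x
    · simp only [Multiset.card_add, Multiset.card_singleton, Multiset.card_map,
        Multiset.card_range, Finset.card_val, Finset.card_univ, hF]
      omega
  rw [h, Multiset.map_add, Multiset.map_singleton, Multiset.map_map]
  rfl

theorem quartic_pow_four (hg : ∀ x, x ∈ Subgroup.zpowers g) (hχ : χ g = gaussI) : χ ^ 4 = 1 := by
  refine MulChar.ext fun x => ?_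
  obtain ⟨k, hk⟩ := exists_pow_eq hg x.ne_zero
  rw [MulChar.pow_apply_coe, MulChar.one_apply_coe, hk, mulChar_generator_pow hχ, ← pow_mul,
    mul_comm, pow_mul, gaussI_pow_four, one_pow]

/-- If -1 = g^k then 4m divides 2k, and m even gives 4 ∣ k. -/
theorem quartic_neg_one (hm : 0 < m) (hm2 : Even m) (hF : Fintype.card F = 4 * m + 1)
    (hg : ∀ x, x ∈ Subgroup.zpowers g) (hχ : χ g = gaussI) : χ (-1) = 1 := by
  obtain ⟨k, hk⟩ := exists_pow_eq hg (neg_ne_zero.2 (one_ne_zero (α := F)))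
  have h1 : g ^ (2 * k) = 1 := Units.ext (by rw [mul_comm, pow_mul]; simp [← hk])
  have h2 := orderOf_dvd_of_pow_eq_one h1
  rw [orderOf_generator hF hg] at h2
  rw [hk, mulChar_generator_pow hχ, gaussI_pow_eq_one_iff]
  obtain ⟨s, rfl⟩ := hm2
  obtain ⟨t, ht⟩ := h2
  exact ⟨s * t, by linarith⟩

theorem mem_powerSet_iff (hg : ∀ x, x ∈ Subgroup.zpowers g) (hχ : χ g = gaussI) {s : F} :
    s ∈ powerSet 4 F ↔ χ s = 1 := by
  constructor
  · rintro ⟨x, hx, rfl⟩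
    obtain ⟨k, rfl⟩ := exists_pow_eq hg hx
    rw [map_pow, mulChar_generator_pow hχ, ← pow_mul, mul_comm, pow_mul, gaussI_pow_four, one_pow]
  · intro h
    have hs : s ≠ 0 := by rintro rfl; rw [MulChar.map_zero] at h; exact zero_ne_one h
    obtain ⟨k, rfl⟩ := exists_pow_eq hg hs
    rw [mulChar_generator_pow hχ, gaussI_pow_eq_one_iff] at h
    obtain ⟨t, rfl⟩ := h
    exact ⟨(g : F) ^ t, pow_ne_zero _ g.ne_zero, by rw [← pow_mul, mul_comm]⟩

open Classical in
/-- The indicator function of the set of fourth powers as a combination of characters. -/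
theorem indicator_powerSet (hg : ∀ x, x ∈ Subgroup.zpowers g) (hχ : χ g = gaussI) (s : F) :
    (if s ∈ powerSet 4 F then (1 : ℂ) else 0) =
      ((1 : MulChar F ℂ) s + complexChar χ s + (complexChar χ ^ 2) s
        + (complexChar χ ^ 3) s) / 4 := by
  rcases eq_or_ne s 0 with rfl | hs
  · rw [if_neg, MulChar.map_zero, MulChar.map_zero, MulChar.map_zero, MulChar.map_zero]
    · norm_num
    · rintro ⟨x, hx, h⟩
      exact pow_ne_zero 4 hx h.symm
  rw [mem_powerSet_iff hg hχ, MulChar.one_apply hs.isUnit, MulChar.pow_apply' _ two_ne_zero,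
    MulChar.pow_apply' _ three_ne_zero, complexChar, MulChar.ringHomComp_apply]
  obtain ⟨k, rfl⟩ := exists_pow_eq hg hs
  have h4 : (χ ((g : F) ^ k)) ^ 4 = 1 := by
    rw [mulChar_generator_pow hχ, ← pow_mul, mul_comm, pow_mul, gaussI_pow_four, one_pow]
  generalize χ ((g : F) ^ k) = w at h4 ⊢
  split_ifs with h
  · rw [h, map_one]; norm_num
  · have h0 : (toComplex w - 1) * (1 + toComplex w + toComplex w ^ 2 + toComplex w ^ 3) = 0 := by
      have := congrArg toComplex h4
      rw [map_pow, map_one] at this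
      linear_combination this
    have h1 : toComplex w - 1 ≠ 0 := by
      rw [sub_ne_zero, ← map_one toComplex]
      exact fun h2 => h (toComplex_injective h2)
    rw [(mul_eq_zero.1 h0).resolve_left h1, zero_div]

open Classical in
/-- The quartic Gaussian periods in terms of Gauss sums. -/
theorem sum_powerSet_eq (hg : ∀ x, x ∈ Subgroup.zpowers g) (hχ : χ g = gaussI) (ψ : AddChar F ℂ)
    (a : F) :
    (∑ s, if s ∈ powerSet 4 F then ψ (s * a) else 0) =
      (gaussSum 1 (ψ.mulShift a) + gaussSum (complexChar χ) (ψ.mulShift a)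
        + gaussSum (complexChar χ ^ 2) (ψ.mulShift a)
        + gaussSum (complexChar χ ^ 3) (ψ.mulShift a)) / 4 := by
  simp only [gaussSum, ← Finset.sum_add_distrib, Finset.sum_div, AddChar.mulShift_apply]
  refine Finset.sum_congr rfl fun s _ => ?_
  have h := indicator_powerSet hg hχ s
  rw [← add_mul, ← add_mul, ← add_mul, mul_div_right_comm, ← h, mul_comm a s]
  split_ifs <;> simp

/-- The eigenvalue of the quartic Paley graph at a power of a generator, in terms of the Gauss
sums of the nontrivial quartic characters. -/
noncomputable def periodOfGauss (G₁ G₂ G₃ : ℂ) (k : ℕ) : ℂ :=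
  (-1 + (-Complex.I) ^ k * G₁ + (-1) ^ k * G₂ + Complex.I ^ k * G₃) / 4

theorem sum_powerSet_generator_pow (hχ : χ g = gaussI)
    {ψ : AddChar F ℂ} (hψ : ψ.IsPrimitive) (k : ℕ) :
    (gaussSum 1 (ψ.mulShift ((g : F) ^ k)) + gaussSum (complexChar χ) (ψ.mulShift ((g : F) ^ k))
        + gaussSum (complexChar χ ^ 2) (ψ.mulShift ((g : F) ^ k))
        + gaussSum (complexChar χ ^ 3) (ψ.mulShift ((g : F) ^ k))) / 4 =
      periodOfGauss (gaussSum (complexChar χ) ψ) (gaussSum (complexChar χ ^ 2) ψ)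
        (gaussSum (complexChar χ ^ 3) ψ) k := by
  have hc := complexChar_generator_pow hχ k
  have h0 : gaussSum (1 : MulChar F ℂ) (ψ.mulShift ((g : F) ^ k)) = -1 :=
    gaussSum_one_left (hψ (pow_ne_zero k g.ne_zero))
  have h1 := gaussSum_mulShift (complexChar χ) ψ (g ^ k)
  have h2 := gaussSum_mulShift (complexChar χ ^ 2) ψ (g ^ k)
  have h3 := gaussSum_mulShift (complexChar χ ^ 3) ψ (g ^ k)
  rw [MulChar.pow_apply_coe] at h2 h3
  rw [Units.val_pow_eq_pow_val, hc] at h1 h2 h3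
  rw [h0, ← h1, ← h2, ← h3, periodOfGauss]
  -- Shifting ψ by g^k multiplies each Gauss sum by the inverse of its character value there; these
  -- identities supply the inverses.
  have e1 : (-Complex.I) ^ k * Complex.I ^ k = 1 := by
    rw [← mul_pow, neg_mul, Complex.I_mul_I, neg_neg, one_pow]
  have e2 : (-1) ^ k * (Complex.I ^ k) ^ 2 = 1 := by
    rw [← pow_mul, mul_comm k 2, pow_mul, Complex.I_sq, ← mul_pow]; norm_num
  have e3 : Complex.I ^ k * (Complex.I ^ k) ^ 3 = 1 := by
    rw [← pow_succ', ← pow_mul, mul_comm, pow_mul, show 3 + 1 = 4 from rfl, Complex.I_pow_four,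
      one_pow]
  rw [← mul_assoc, ← mul_assoc, ← mul_assoc, e1, e2, e3]
  ring

/-- The spectrum of the quartic Paley graph in terms of Gauss sums. -/
theorem spec_genPaley_eq_gauss (hF : Fintype.card F = 4 * m + 1)
    (hg : ∀ x, x ∈ Subgroup.zpowers g) (hχ : χ g = gaussI) {ψ : AddChar F ℂ}
    (hψ : ψ.IsPrimitive) :
    let E := periodOfGauss (gaussSum (complexChar χ) ψ) (gaussSum (complexChar χ ^ 2) ψ)
      (gaussSum (complexChar χ ^ 3) ψ)
    spec (genPaley 4 F) = {(m : ℂ)} + m • ({E 0} + {E 1} + {E 2} + {E 3}) := by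
  intro E
  classical
  rw [genPaley, spec_cayleyDigraph hψ, map_univ_eq hF hg]
  congr 1
  · rw [sum_powerSet_eq hg hχ, AddChar.mulShift_zero, gaussSum_one_one,
      gaussSum_one_right (complexChar_ne_one hχ),
      gaussSum_one_right (complexChar_pow_ne_one (quartic_sq_ne_one hχ)),
      gaussSum_one_right (complexChar_pow_ne_one (quartic_cube_ne_one hχ)),
      Nat.card_eq_fintype_card, Fintype.card_units, hF, Nat.add_sub_cancel]
    push_cast
    congr 1
    ring
  · rw [← map_range_four_mul m (f := E)]
    · refine Multiset.map_congr rfl fun k _ => ?_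
      rw [sum_powerSet_eq hg hχ, sum_powerSet_generator_pow hχ hψ]
    · intro k
      simp only [E, periodOfGauss, pow_add, Complex.I_pow_four, neg_pow Complex.I 4]
      norm_num

end Eigenvalues

/-! ### Evaluation of the periods and the spectrum -/

/-- The values of the Gauss sums that are compatible with their products and with the Jacobi sum
all give the same periods. -/
theorem periods_eq {P Z W G₁ G₂ G₃ : ℂ} (hP : P ≠ 0) (hZW : Z * W = P ^ 2)
    (h13 : G₁ * G₃ = P ^ 4) (h2 : G₂ ^ 2 = P ^ 4)
    (h1 : G₁ ^ 2 = -Z ^ 2 * G₂ ∨ G₁ ^ 2 = -W ^ 2 * G₂) :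
    ({periodOfGauss G₁ G₂ G₃ 0} + {periodOfGauss G₁ G₂ G₃ 1} + {periodOfGauss G₁ G₂ G₃ 2}
      + {periodOfGauss G₁ G₂ G₃ 3} : Multiset ℂ) =
    {(P ^ 2 - Complex.I * (Z - W) * P - 1) / 4} + {(P ^ 2 + Complex.I * (Z - W) * P - 1) / 4}
      + {(-P ^ 2 + (Z + W) * P - 1) / 4} + {(-P ^ 2 - (Z + W) * P - 1) / 4} := by
  have hI := Complex.I_mul_I
  have main : ∀ Z W : ℂ, Z * W = P ^ 2 → G₁ ^ 2 = -Z ^ 2 * G₂ →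
      ({periodOfGauss G₁ G₂ G₃ 0} + {periodOfGauss G₁ G₂ G₃ 1} + {periodOfGauss G₁ G₂ G₃ 2}
        + {periodOfGauss G₁ G₂ G₃ 3} : Multiset ℂ) =
      {(P ^ 2 - Complex.I * (Z - W) * P - 1) / 4} + {(P ^ 2 + Complex.I * (Z - W) * P - 1) / 4}
        + {(-P ^ 2 + (Z + W) * P - 1) / 4} + {(-P ^ 2 - (Z + W) * P - 1) / 4} := by
    intro Z W hZW h1
    have hZ : Z ≠ 0 := by
      rintro rfl
      rw [zero_mul] at hZW
      exact pow_ne_zero 2 hP hZW.symm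
    have hPZ : P * Z ≠ 0 := mul_ne_zero hP hZ
    have e0 : periodOfGauss G₁ G₂ G₃ 0 = (-1 + G₁ + G₂ + G₃) / 4 := by
      rw [periodOfGauss]; ring
    have e1 : periodOfGauss G₁ G₂ G₃ 1 = (-1 - Complex.I * G₁ - G₂ + Complex.I * G₃) / 4 := by
      rw [periodOfGauss]; ring
    have e2 : periodOfGauss G₁ G₂ G₃ 2 = (-1 - G₁ + G₂ - G₃) / 4 := by
      rw [periodOfGauss]; linear_combination (G₁ + G₃) / 4 * hI
    have e3 : periodOfGauss G₁ G₂ G₃ 3 = (-1 + Complex.I * G₁ - G₂ - Complex.I * G₃) / 4 := by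
      rw [periodOfGauss]; linear_combination Complex.I * (G₃ - G₁) / 4 * hI
    -- If G₂ = P² then G₁ = ±iPZ; if G₂ = -P² then G₁ = ±PZ. In both cases G₁G₃ = P⁴ gives G₃, and
    -- the sign s only exchanges periods 0 with 2 and 1 with 3.
    have h2' : (G₂ - P ^ 2) * (G₂ + P ^ 2) = 0 := by linear_combination h2
    rcases mul_eq_zero.1 h2' with h | h
    · obtain ⟨s, hs, rfl⟩ : ∃ s : ℂ, (s = 1 ∨ s = -1) ∧ G₁ = s * Complex.I * (P * Z) := by
        have h3 : (G₁ - Complex.I * (P * Z)) * (G₁ + Complex.I * (P * Z)) = 0 := by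
          linear_combination h1 - Z ^ 2 * h - (P * Z) ^ 2 * hI
        rcases mul_eq_zero.1 h3 with h | h
        · exact ⟨1, Or.inl rfl, by linear_combination h⟩
        · exact ⟨-1, Or.inr rfl, by linear_combination h⟩
      have hs2 : s * s = 1 := by rcases hs with rfl | rfl <;> norm_num
      have hs0 : s ≠ 0 := by rintro rfl; norm_num at hs2
      have h3 : G₃ = -s * Complex.I * (P * W) :=
        mul_left_cancel₀ (mul_ne_zero (mul_ne_zero hs0 Complex.I_ne_zero) hPZ) (by
          linear_combination h13 - P ^ 2 * hZW + P ^ 2 * Z * W * (s * s) * hI - P ^ 2 * Z * W * hs2)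
      have t0 : periodOfGauss (s * Complex.I * (P * Z)) G₂ G₃ 0
          = (P ^ 2 + s * (Complex.I * (Z - W) * P) - 1) / 4 := by
        rw [e0, h3]; linear_combination h / 4
      have t1 : periodOfGauss (s * Complex.I * (P * Z)) G₂ G₃ 1
          = (-P ^ 2 + s * ((Z + W) * P) - 1) / 4 := by
        rw [e1, h3]; linear_combination -h / 4 - s * P * (Z + W) / 4 * hI
      have t2 : periodOfGauss (s * Complex.I * (P * Z)) G₂ G₃ 2
          = (P ^ 2 - s * (Complex.I * (Z - W) * P) - 1) / 4 := by
        rw [e2, h3]; linear_combination h / 4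
      have t3 : periodOfGauss (s * Complex.I * (P * Z)) G₂ G₃ 3
          = (-P ^ 2 - s * ((Z + W) * P) - 1) / 4 := by
        rw [e3, h3]; linear_combination -h / 4 + s * P * (Z + W) / 4 * hI
      rw [t0, t1, t2, t3]
      rcases hs with rfl | rfl
      · simp only [one_mul]
        abel
      · simp only [neg_mul, one_mul, sub_neg_eq_add, ← sub_eq_add_neg]
        abel
    · obtain ⟨s, hs, rfl⟩ : ∃ s : ℂ, (s = 1 ∨ s = -1) ∧ G₁ = s * (P * Z) := by
        have h3 : (G₁ - P * Z) * (G₁ + P * Z) = 0 := by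
          linear_combination h1 - Z ^ 2 * h
        rcases mul_eq_zero.1 h3 with h | h
        · exact ⟨1, Or.inl rfl, by linear_combination h⟩
        · exact ⟨-1, Or.inr rfl, by linear_combination h⟩
      have hs2 : s * s = 1 := by rcases hs with rfl | rfl <;> norm_num
      have hs0 : s ≠ 0 := by rintro rfl; norm_num at hs2
      have h3 : G₃ = s * (P * W) :=
        mul_left_cancel₀ (mul_ne_zero hs0 hPZ) (by
          linear_combination h13 - P ^ 2 * hZW - P ^ 2 * Z * W * hs2)
      have t0 : periodOfGauss (s * (P * Z)) G₂ G₃ 0 = (-P ^ 2 + s * ((Z + W) * P) - 1) / 4 := by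
        rw [e0, h3]; linear_combination h / 4
      have t1 : periodOfGauss (s * (P * Z)) G₂ G₃ 1
          = (P ^ 2 - s * (Complex.I * (Z - W) * P) - 1) / 4 := by
        rw [e1, h3]; linear_combination -h / 4
      have t2 : periodOfGauss (s * (P * Z)) G₂ G₃ 2 = (-P ^ 2 - s * ((Z + W) * P) - 1) / 4 := by
        rw [e2, h3]; linear_combination h / 4
      have t3 : periodOfGauss (s * (P * Z)) G₂ G₃ 3
          = (P ^ 2 + s * (Complex.I * (Z - W) * P) - 1) / 4 := by
        rw [e3, h3]; linear_combination -h / 4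
      rw [t0, t1, t2, t3]
      rcases hs with rfl | rfl
      · simp only [one_mul]
        abel
      · simp only [neg_mul, one_mul, sub_neg_eq_add, ← sub_eq_add_neg]
        abel
  rcases h1 with h1 | h1
  · exact main Z W hZW h1
  -- Conjugation swaps Z and W, which only exchanges the first two listed values.
  · rw [main W Z (by rw [mul_comm]; exact hZW) h1,
      show Complex.I * (W - Z) = -(Complex.I * (Z - W)) by ring, add_comm W Z]
    simp only [neg_mul, sub_neg_eq_add, ← sub_eq_add_neg]
    abel

theorem toComplex_baseElt (c d : ℤ) :
    toComplex (baseElt c d) = (c : ℂ) + 2 * d * Complex.I := by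
  simp [baseElt, toComplex_def]

theorem toComplex_star_baseElt (c d : ℤ) :
    toComplex (star (baseElt c d)) = (c : ℂ) - 2 * d * Complex.I := by
  simp [baseElt, toComplex_def]; ring

theorem specForm_eq (p l : ℕ) (c d : ℂ) :
    specForm p l c d = {(nSeq p l : ℂ)} + nSeq p l •
      ({((p : ℂ) ^ (2 * l) + 4 * d * (p : ℂ) ^ l - 1) / 4}
        + {((p : ℂ) ^ (2 * l) - 4 * d * (p : ℂ) ^ l - 1) / 4}
        + {(-(p : ℂ) ^ (2 * l) + 2 * c * (p : ℂ) ^ l - 1) / 4}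
        + {(-(p : ℂ) ^ (2 * l) - 2 * c * (p : ℂ) ^ l - 1) / 4} : Multiset ℂ) := by
  simp only [specForm, nonPrincipal, List.map_cons, List.map_nil, List.sum_cons, List.sum_nil,
    ← Multiset.nsmul_singleton, nsmul_add, add_zero, add_assoc]

theorem specForm_neg_left (p l : ℕ) (c d : ℂ) : specForm p l (-c) d = specForm p l c d := by
  simp only [specForm_eq, mul_neg, neg_mul, sub_neg_eq_add, ← sub_eq_add_neg]
  congr 2
  abel

theorem specForm_neg_right (p l : ℕ) (c d : ℂ) : specForm p l c (-d) = specForm p l c d := by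
  simp only [specForm_eq, mul_neg, neg_mul, sub_neg_eq_add, ← sub_eq_add_neg]
  congr 2
  abel

theorem four_mul_nSeq {p : ℕ} (hp : p.Prime) (h4 : p ≡ 1 [MOD 4]) (l : ℕ) :
    p ^ (4 * l) = 4 * nSeq p l + 1 := by
  have h1 : p ^ (4 * l) ≡ 1 [MOD 4] := by simpa using h4.pow (4 * l)
  have h2 := Nat.mul_div_cancel' ((Nat.modEq_iff_dvd' (Nat.one_le_pow _ _ hp.pos)).1 h1.symm)
  have h3 := Nat.one_le_pow (4 * l) p hp.pos
  rw [nSeq, h2]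
  omega

/-- Since p² is 1 modulo 8, so is p^(4l). Evenness makes the quartic character trivial at -1. -/
theorem even_nSeq {p : ℕ} (hp : p.Prime) (h4 : p ≡ 1 [MOD 4]) (l : ℕ) : Even (nSeq p l) := by
  have h1 := four_mul_nSeq hp h4 l
  have h4' : p % 4 = 1 := h4
  obtain ⟨t, ht⟩ : ∃ t, p = 4 * t + 1 := ⟨p / 4, by omega⟩
  have h2 : p ^ 2 ≡ 1 [MOD 8] := by
    have : p ^ 2 = 8 * (2 * t ^ 2 + t) + 1 := by rw [ht]; ring
    rw [this]
    exact Nat.mul_add_mod _ _ _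
  have h3 : p ^ (4 * l) % 8 = 1 := by
    have : p ^ (4 * l) ≡ 1 [MOD 8] := by
      rw [show 4 * l = 2 * (2 * l) by ring, pow_mul]
      simpa using h2.pow (2 * l)
    exact this
  rw [Nat.even_iff]
  omega

theorem nSeq_pos {p : ℕ} (hp : p.Prime) (h4 : p ≡ 1 [MOD 4]) {l : ℕ} (hl : 1 ≤ l) :
    0 < nSeq p l := by
  have h1 := four_mul_nSeq hp h4 l
  have h2 := Nat.one_lt_pow (show 4 * l ≠ 0 by omega) hp.one_lt
  omega

/-- The spectrum of `Γ(4, p ^ (4 * l))`. -/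
theorem spec_genPaley_four {p : ℕ} (hp : p.Prime) (h4 : p ≡ 1 [MOD 4]) {c d : ℤ}
    (h : IsBaseSolution p c d) {l : ℕ} (hl : 1 ≤ l) {F : Type*} [Field F] [Fintype F]
    (hF : Fintype.card F = p ^ (4 * l)) :
    spec (genPaley 4 F) = specForm p l (cSeq c d l) (dSeq c d l) := by
  have hn := nSeq_pos hp h4 hl
  have hF' : Fintype.card F = 4 * nSeq p l + 1 := hF.trans (four_mul_nSeq hp h4 l)
  obtain ⟨g, hg⟩ := IsCyclic.exists_generator (α := Fˣ)
  obtain ⟨χ, hχ⟩ := exists_quartic_mulChar hF' hg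
  have hψ := AddChar.FiniteField.primitiveChar_to_Complex_isPrimitive F
  set ψ := AddChar.FiniteField.primitiveChar_to_Complex F
  have hneg : complexChar χ (-1) = 1 := by
    rw [complexChar, MulChar.ringHomComp_apply,
      quartic_neg_one hn (even_nSeq hp h4 l) hF' hg hχ, map_one]
  have hc4 : complexChar χ ^ 4 = 1 := by
    rw [complexChar, MulChar.ringHomComp_pow, quartic_pow_four hg hχ, MulChar.ringHomComp_one]
  have hinv : (complexChar χ)⁻¹ = complexChar χ ^ 3 :=
    inv_eq_of_mul_eq_one_right (by rw [← pow_succ', hc4])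
  have hinv2 : (complexChar χ ^ 2)⁻¹ = complexChar χ ^ 2 :=
    inv_eq_of_mul_eq_one_right (by rw [← pow_add, hc4])
  have h13 := gaussSum_mul_gaussSum_inv (complexChar_ne_one hχ) hneg hψ
  have h22 := gaussSum_mul_gaussSum_inv (complexChar_pow_ne_one (quartic_sq_ne_one hχ))
    (by rw [MulChar.pow_apply' _ two_ne_zero, hneg, one_pow]) hψ
  rw [hinv] at h13
  rw [hinv2, ← sq] at h22
  have hJ := jacobiSum_mul_nontrivial (χ := complexChar χ) (φ := complexChar χ ^ 2)
    (by rw [← pow_succ']; exact complexChar_pow_ne_one (quartic_cube_ne_one hχ)) ψ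
  have hJ' : jacobiSum (complexChar χ) (complexChar χ ^ 2) = toComplex (jacobiSum χ (χ ^ 2)) := by
    rw [complexChar, MulChar.ringHomComp_pow, jacobiSum_ringHomComp]
  rw [← pow_succ', show 2 + 1 = 3 from rfl, hJ'] at hJ
  obtain ⟨v, hv⟩ := exists_jacobiSum_add_one_eq hF' hg hχ
  have hJval := eq_neg_pow_of_congr hp h4 h (l := l)
    (by rw [norm_jacobiSum hχ, hF]; push_cast; rfl)
    (not_dvd_jacobiSum hp h4 hn hF' hF hg hχ) hv
  have hcard : (Fintype.card F : ℂ) = ((p : ℂ) ^ l) ^ 4 := by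
    rw [hF]; push_cast; ring
  have hP : (p : ℂ) ^ l ≠ 0 := pow_ne_zero _ (by exact_mod_cast hp.ne_zero)
  rw [hcard] at h13 h22
  rw [spec_genPaley_eq_gauss hF' hg hχ hψ]
  set G₁ := gaussSum (complexChar χ) ψ
  set G₂ := gaussSum (complexChar χ ^ 2) ψ
  set G₃ := gaussSum (complexChar χ ^ 3) ψ
  set P := (p : ℂ) ^ l with hPdef
  -- Multiply G₃J = G₁G₂ by G₁G₂, use G₁G₃ = G₂² = P⁴, and cancel P⁴.
  have hsq : G₁ ^ 2 = toComplex (jacobiSum χ (χ ^ 2)) * G₂ := by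
    refine mul_right_cancel₀ (pow_ne_zero 4 hP) ?_
    linear_combination (-G₁ ^ 2) * h22 - G₁ * G₂ * hJ +
      toComplex (jacobiSum χ (χ ^ 2)) * G₂ * h13
  have hZW : ((c : ℂ) + 2 * d * Complex.I) ^ l * ((c : ℂ) - 2 * d * Complex.I) ^ l = P ^ 2 := by
    have h1 : ((p : ℂ)) ^ 2 = c ^ 2 + 4 * d ^ 2 := by exact_mod_cast h.1
    rw [← mul_pow, hPdef, pow_right_comm, h1]
    congr 1
    linear_combination (-4 * (d : ℂ) ^ 2) * Complex.I_mul_I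
  have h1 : G₁ ^ 2 = -(((c : ℂ) + 2 * d * Complex.I) ^ l) ^ 2 * G₂ ∨
      G₁ ^ 2 = -(((c : ℂ) - 2 * d * Complex.I) ^ l) ^ 2 * G₂ := by
    rw [hsq]
    refine hJval.imp (fun e => ?_) (fun e => ?_)
    · rw [e, map_neg, map_pow, toComplex_baseElt, ← pow_mul, mul_comm 2 l]
    · rw [e, map_neg, map_pow, toComplex_star_baseElt, ← pow_mul, mul_comm 2 l]
  rw [periods_eq hP hZW h13 h22 h1, specForm_eq, ← hPdef, mul_comm 2 l, pow_mul, ← hPdef]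
  have ec : 2 * cSeq c d l
      = ((c : ℂ) + 2 * d * Complex.I) ^ l + ((c : ℂ) - 2 * d * Complex.I) ^ l := by
    rw [cSeq]; ring
  have ed : 4 * dSeq c d l
      = -(Complex.I *
        (((c : ℂ) + 2 * d * Complex.I) ^ l - ((c : ℂ) - 2 * d * Complex.I) ^ l)) := by
    rw [dSeq]; ring
  rw [ec, ed]
  simp only [neg_mul, sub_neg_eq_add, ← sub_eq_add_neg]

/-! ### Recovering p, c, d from the spectrum -/

theorem cSeq_neg_right (c d : ℤ) (l : ℕ) : cSeq c (-d) l = cSeq c d l := by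
  simp only [cSeq, Int.cast_neg, mul_neg, neg_mul, sub_neg_eq_add, ← sub_eq_add_neg]; ring

theorem dSeq_neg_right (c d : ℤ) (l : ℕ) : dSeq c (-d) l = -dSeq c d l := by
  simp only [dSeq, Int.cast_neg, mul_neg, neg_mul, sub_neg_eq_add, ← sub_eq_add_neg]; ring

theorem cSeq_neg_left (c d : ℤ) (l : ℕ) : cSeq (-c) d l = (-1) ^ l * cSeq c d l := by
  have e1 : ((-c : ℤ) : ℂ) + 2 * d * Complex.I = -1 * (c - 2 * d * Complex.I) := by
    push_cast; ring
  have e2 : ((-c : ℤ) : ℂ) - 2 * d * Complex.I = -1 * (c + 2 * d * Complex.I) := by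
    push_cast; ring
  rw [cSeq, cSeq, e1, e2, mul_pow, mul_pow]; ring

theorem dSeq_neg_left (c d : ℤ) (l : ℕ) : dSeq (-c) d l = -((-1) ^ l * dSeq c d l) := by
  have e1 : ((-c : ℤ) : ℂ) + 2 * d * Complex.I = -1 * (c - 2 * d * Complex.I) := by
    push_cast; ring
  have e2 : ((-c : ℤ) : ℂ) - 2 * d * Complex.I = -1 * (c + 2 * d * Complex.I) := by
    push_cast; ring
  rw [dSeq, dSeq, e1, e2, mul_pow, mul_pow]; ring

theorem specForm_seq_neg_right (p l : ℕ) (c d : ℤ) :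
    specForm p l (cSeq c (-d) l) (dSeq c (-d) l) = specForm p l (cSeq c d l) (dSeq c d l) := by
  rw [cSeq_neg_right, dSeq_neg_right, specForm_neg_right]

theorem specForm_seq_neg_left (p l : ℕ) (c d : ℤ) :
    specForm p l (cSeq (-c) d l) (dSeq (-c) d l) = specForm p l (cSeq c d l) (dSeq c d l) := by
  rw [cSeq_neg_left, dSeq_neg_left, specForm_neg_right]
  rcases neg_one_pow_eq_or ℂ l with h | h
  · rw [h, one_mul, one_mul]
  · rw [h, neg_one_mul, neg_one_mul, specForm_neg_left, specForm_neg_right]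

/-- The spectrum determines `c` and `d` up to sign: compare power sums of the eigenvalues. -/
theorem eq_or_neg_of_specForm_eq {p : ℕ} (hp : p.Prime) (h4 : p ≡ 1 [MOD 4]) {c d c' d' : ℤ}
    (h : specForm p 1 c d = specForm p 1 c' d') : (c = c' ∨ c = -c') ∧ (d = d' ∨ d = -d') := by
  have hn : (nSeq p 1 : ℂ) ≠ 0 := by exact_mod_cast (nSeq_pos hp h4 le_rfl).ne'
  have hp0 : (p : ℂ) ≠ 0 := by exact_mod_cast hp.ne_zero
  -- The substitution x ↦ (4x + 1)/p turns the four values into p ± 4d and -p ± 2c. Their sum is 0,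
  -- but the squares give 4d² + c² and the cubes 4d² - c².
  have key : ∀ k : ℕ, ∀ c d : ℂ,
      ((specForm p 1 c d).map fun x : ℂ => ((4 * x + 1) / (p : ℂ)) ^ k).sum =
        ((4 * (nSeq p 1 : ℂ) + 1) / p) ^ k + (nSeq p 1 : ℂ) *
          ((p + 4 * d) ^ k + (p - 4 * d) ^ k + (-p + 2 * c) ^ k + (-p - 2 * c) ^ k) := by
    intro k c d
    have e : ∀ a : ℂ, (4 * ((p * a - 1) / 4) + 1) / p = a := fun a => by field_simp; ring
    have f1 : ((p : ℂ) ^ (2 * 1) + 4 * d * (p : ℂ) ^ 1 - 1) / 4 = (p * (p + 4 * d) - 1) / 4 := by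
      ring
    have f2 : ((p : ℂ) ^ (2 * 1) - 4 * d * (p : ℂ) ^ 1 - 1) / 4 = (p * (p - 4 * d) - 1) / 4 := by
      ring
    have f3 : (-(p : ℂ) ^ (2 * 1) + 2 * c * (p : ℂ) ^ 1 - 1) / 4 = (p * (-p + 2 * c) - 1) / 4 := by
      ring
    have f4 : (-(p : ℂ) ^ (2 * 1) - 2 * c * (p : ℂ) ^ 1 - 1) / 4 = (p * (-p - 2 * c) - 1) / 4 := by
      ring
    rw [specForm_eq, f1, f2, f3, f4]
    simp only [Multiset.map_add, Multiset.map_nsmul, Multiset.map_singleton, Multiset.sum_add,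
      Multiset.sum_nsmul, Multiset.sum_singleton, e, nsmul_eq_mul]
  have h2 := key 2 c d
  rw [h, key 2 c' d'] at h2
  have h3 := key 3 c d
  rw [h, key 3 c' d'] at h3
  have h2' := mul_left_cancel₀ hn (add_left_cancel h2.symm)
  have h3' := mul_left_cancel₀ hn (add_left_cancel h3.symm)
  have g3 : (4 * (d : ℂ) ^ 2 - c ^ 2) = 4 * d' ^ 2 - c' ^ 2 := by
    refine mul_left_cancel₀ (mul_ne_zero (by norm_num : (24 : ℂ) ≠ 0) hp0) ?_
    linear_combination h3'
  have gc : (c : ℂ) ^ 2 = c' ^ 2 := by linear_combination h2' / 16 - g3 / 2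
  have gd : (d : ℂ) ^ 2 = d' ^ 2 := by linear_combination h2' / 64 + g3 / 8
  exact ⟨sq_eq_sq_iff_eq_or_eq_neg.1 (by exact_mod_cast gc),
    sq_eq_sq_iff_eq_or_eq_neg.1 (by exact_mod_cast gd)⟩

theorem specForm_seq_eq_of_specForm_eq {p : ℕ} (hp : p.Prime) (h4 : p ≡ 1 [MOD 4])
    {c d c' d' : ℤ} (h : specForm p 1 c d = specForm p 1 c' d') (l : ℕ) :
    specForm p l (cSeq c d l) (dSeq c d l) = specForm p l (cSeq c' d' l) (dSeq c' d' l) := by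
  obtain ⟨rfl | rfl, rfl | rfl⟩ := eq_or_neg_of_specForm_eq hp h4 h
  · rfl
  · exact specForm_seq_neg_right _ _ _ _
  · exact specForm_seq_neg_left _ _ _ _
  · rw [specForm_seq_neg_right, specForm_seq_neg_left]

theorem spec_genPaley_four_one {p : ℕ} (hp : p.Prime) (h4 : p ≡ 1 [MOD 4]) {c d : ℤ}
    (h : IsBaseSolution p c d) {F : Type*} [Field F] [Fintype F]
    (hF : Fintype.card F = p ^ 4) : spec (genPaley 4 F) = specForm p 1 c d := by
  have e1 : cSeq c d 1 = c := by rw [cSeq]; ring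
  have e2 : dSeq c d 1 = d := by rw [dSeq]; linear_combination (-(d : ℂ)) * Complex.I_mul_I
  rw [spec_genPaley_four hp h4 h le_rfl hF, e1, e2]

/-- The spectrum of `Γ(4, p ^ (4 * l))` from any description of the spectrum of `Γ(4, p ^ 4)`. -/
theorem spec_genPaley_four_of_spec {p : ℕ} (hp : p.Prime) (h4 : p ≡ 1 [MOD 4]) {l : ℕ}
    (hl : 1 ≤ l) {K : Type*} [Field K] [Fintype K] {L : Type*} [Field L] [Fintype L]
    (hK : Fintype.card K = p ^ 4) (hL : Fintype.card L = p ^ (4 * l)) {c d : ℤ}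
    (h : spec (genPaley 4 K) = specForm p 1 c d) :
    spec (genPaley 4 L) = specForm p l (cSeq c d l) (dSeq c d l) := by
  obtain ⟨c₁, d₁, h₁⟩ := exists_isBaseSolution hp h4
  rw [spec_genPaley_four hp h4 h₁ hl hL]
  exact specForm_seq_eq_of_specForm_eq hp h4
    ((spec_genPaley_four_one hp h4 h₁ hK).symm.trans h) l

/-- For l = 1 the size p⁴ recovers p, which lets one map serve all primes. -/
theorem card_specForm {p : ℕ} (hp : p.Prime) (h4 : p ≡ 1 [MOD 4]) (l : ℕ) (c d : ℂ) :
    (specForm p l c d).card = p ^ (4 * l) := by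
  rw [four_mul_nSeq hp h4 l, specForm_eq]
  simp only [Multiset.card_add, Multiset.card_nsmul, Multiset.card_singleton]
  ring

/-- A spectrum of the form of that of `Γ(4, p ^ 4)` determines the multisets for all `l`. -/
theorem specForm_seq_eq_of_specForm_eq' {p p' : ℕ} (hp : p.Prime) (h4 : p ≡ 1 [MOD 4])
    (hp' : p'.Prime) (h4' : p' ≡ 1 [MOD 4]) {c d c' d' : ℤ}
    (h : specForm p 1 c d = specForm p' 1 c' d') (l : ℕ) :
    specForm p l (cSeq c d l) (dSeq c d l) = specForm p' l (cSeq c' d' l) (dSeq c' d' l) := by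
  have hc := congrArg Multiset.card h
  rw [card_specForm hp h4, card_specForm hp' h4'] at hc
  obtain rfl := Nat.pow_left_injective (by norm_num) hc
  exact specForm_seq_eq_of_specForm_eq hp h4 h l

/-- The map that takes the spectrum of `Γ(4, p ^ 4)` to that of `Γ(4, p ^ (4 * l))`. -/
theorem exists_spec_map : ∃ F : ℕ → Multiset ℂ → Multiset ℂ, ∀ p : ℕ, p.Prime → p ≡ 1 [MOD 4] →
    ∀ c d : ℤ, ∀ l, F l (specForm p 1 c d) = specForm p l (cSeq c d l) (dSeq c d l) := by
  classical
  -- Any triple (p, c, d) describing s may be chosen, as all give the same result; the value 0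
  -- elsewhere is arbitrary.
  refine ⟨fun l s => if h : ∃ t : ℕ × ℤ × ℤ, t.1.Prime ∧ t.1 ≡ 1 [MOD 4] ∧
    s = specForm t.1 1 t.2.1 t.2.2 then specForm h.choose.1 l
      (cSeq h.choose.2.1 h.choose.2.2 l) (dSeq h.choose.2.1 h.choose.2.2 l) else 0,
    fun p hp h4 c d l => ?_⟩
  have h : ∃ t : ℕ × ℤ × ℤ, t.1.Prime ∧ t.1 ≡ 1 [MOD 4] ∧
      specForm p 1 c d = specForm t.1 1 t.2.1 t.2.2 := ⟨(p, c, d), hp, h4, rfl⟩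
  obtain ⟨hp', h4', e⟩ := h.choose_spec
  refine (dif_pos h).trans ?_
  exact (specForm_seq_eq_of_specForm_eq' hp h4 hp' h4' e l).symm

end GPGraph

/-- (i) `Spec Γ(4,p^{4ℓ})` is a function of `ℓ` and `Spec Γ(4,p⁴)` (the same function for all `p`);
(ii) it is computed from any integers `c, d` that describe `Spec Γ(4,p⁴)`;
(iii) base solutions exist;
(iv) every base solution gives the spectrum, and the five listed eigenvalues are distinct. -/
theorem theorem3p4 :
    (∃ F : ℕ → Multiset ℂ → Multiset ℂ,
      ∀ p : ℕ, p.Prime → p ≡ 1 [MOD 4] → ∀ ℓ : ℕ, 1 ≤ ℓ →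
        ∀ (K : Type*) [Field K] [Fintype K] (L : Type*) [Field L] [Fintype L],
          Fintype.card K = p ^ 4 → Fintype.card L = p ^ (4 * ℓ) →
            GPGraph.spec (GPGraph.genPaley 4 L) = F ℓ (GPGraph.spec (GPGraph.genPaley 4 K))) ∧
    (∀ p : ℕ, p.Prime → p ≡ 1 [MOD 4] → ∀ ℓ : ℕ, 1 ≤ ℓ →
        ∀ (K : Type*) [Field K] [Fintype K] (L : Type*) [Field L] [Fintype L],
          Fintype.card K = p ^ 4 → Fintype.card L = p ^ (4 * ℓ) →
            ∀ c d : ℤ, GPGraph.spec (GPGraph.genPaley 4 K) = GPGraph.specForm p 1 c d →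
              GPGraph.spec (GPGraph.genPaley 4 L) =
                GPGraph.specForm p ℓ (GPGraph.cSeq c d ℓ) (GPGraph.dSeq c d ℓ)) ∧
    (∀ p : ℕ, p.Prime → p ≡ 1 [MOD 4] →
      (∃ c₁ d₁ : ℤ, GPGraph.IsBaseSolution p c₁ d₁) ∧
      ∀ c₁ d₁ : ℤ, GPGraph.IsBaseSolution p c₁ d₁ → ∀ ℓ : ℕ, 1 ≤ ℓ →
        ((GPGraph.nSeq p ℓ : ℂ) ::
          GPGraph.nonPrincipal p ℓ (GPGraph.cSeq c₁ d₁ ℓ) (GPGraph.dSeq c₁ d₁ ℓ)).Nodup ∧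
        ∀ (L : Type*) [Field L] [Fintype L], Fintype.card L = p ^ (4 * ℓ) →
          GPGraph.spec (GPGraph.genPaley 4 L) =
            GPGraph.specForm p ℓ (GPGraph.cSeq c₁ d₁ ℓ) (GPGraph.dSeq c₁ d₁ ℓ)) := by

  refine ⟨?_, ?_, ?_⟩
  · obtain ⟨F, hF⟩ := GPGraph.exists_spec_map
    refine ⟨F, fun p hp h4 l hl K _ _ L _ _ hK hL => ?_⟩
    obtain ⟨c, d, h⟩ := GPGraph.exists_isBaseSolution hp h4
    rw [GPGraph.spec_genPaley_four_one hp h4 h hK, hF p hp h4,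
      GPGraph.spec_genPaley_four hp h4 h hl hL]
  · intro p hp h4 l hl K _ _ L _ _ hK hL c d h
    exact GPGraph.spec_genPaley_four_of_spec hp h4 hl hK hL h
  · intro p hp h4
    refine ⟨GPGraph.exists_isBaseSolution hp h4, fun c d h l hl =>
      ⟨GPGraph.nodup_eigenvalues hp h4 h hl, fun L _ _ hL => ?_⟩⟩
    exact GPGraph.spec_genPaley_four hp h4 h hl hL
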